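/- **Random hypergraph.** For integers $K\ge 2$, $N\ge 1$, $M\ge 0$ let $\mathbb G(N,M)$ consist of $M$ directed hyperedges chosen independently and uniformly at random (with replacement) from $[N]^K$. Its simple version consists of $M$ hyperedges chosen uniformly at random without replacement from the $K$-element subsets of $[N]$ (each listed in a uniformly random order). **Models.** Each model has an alphabet $\{0,\dots,q-1\}$, a node potential $h:\{0,\dots,q-1\}\to\mathbb R$ and, for every hyperedge $e$, a potential $H_e:\{0,\dots,q-1\}^K\to\mathbb R\cup\{-\infty\}$. For $x\in\{0,\dots,q-1\}^N$ put $H(x)=\sum_{i=1}^N h(x_i)+\sum_e H_e(x_e)$, where $x_e$ lists the values of $x$ at the nodes of $e$, and for $\lambda\ge 1$ let $Z(\mathbb G)=\sum_x \lambda^{H(x)}$, with $\lambda^{-\infty}=0$. The models are: * Independent set ($K=q=2$): $h(1)=1$, $h(0)=0$, $H_e(1,1)=-\infty$, and $H_e=0$ otherwise. * MAX-CUT ($K=q=2$): $h=0$, $H_e(x,y)=\mathbf 1\{x\ne y\}$. * Anti-ferromagnetic Ising with parameters $\beta>0$, $B\in\mathbb R$ ($K=q=2$): $h(1)=B$, $h(0)=-B$,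 $H_e(x,y)=-\beta$ if $x=y$ and $\beta$ if $x\neq y$. * $q$-Coloring ($K=2$, any $q\ge 1$): $h=0$, $H_e(x,y)=\mathbf 1\{x\ne y\}$. * K-SAT ($q=2$, any $K\ge 2$): $h=0$; each hyperedge $e$ draws an independent uniform $a_e\in\{0,1\}^K$, and $H_e(y)=0$ if $y=a_e$ and $H_e(y)=1$ otherwise. * NAE-K-SAT ($q=2$, any $K\ge 2$): $h=0$; each hyperedge $e$ draws an independent uniform $a_e\in\{0,1\}^K$, and $H_e(y)=0$ if $y\in\{a_e,\mathbf 1-a_e\}$ and $H_e(y)=1$ otherwise. **Theorem.** Let $\lambda\ge 1$. For each of these models (with its parameters fixed) there is a function $z:(0,\infty)\to\mathbb R$ such that for every $c>0$ $$N^{-1}\log Z(\mathbb G(N,\lfloor cN\rfloor))\to z(c)\quad\text{in probability as } N\to\infty,$$ both for $\mathbb G(N,\lfloor cN\rfloor)$ and for its simple version. The function $z$ is Lipschitz continuous on $(0,\infty)$. It is non-decreasing for MAX-CUT, Coloring, K-SAT and NAE-K-SAT, and non-increasing for Independent set. -/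

import Mathlib

open Set Filter Topology MeasureTheory
open scoped NNReal ENNReal

/-- A Markov random field model on `K`-uniform directed hypergraphs, with spins in
`{0, …, q - 1}`. The node potential is the same real function at every node. The potential of a
hyperedge is a function with values in `{-∞} ∪ ℝ` (`⊥` is `-∞`), and is determined by a mark
which every hyperedge draws uniformly at random from the finite set `Mark`, independently of
everything else. Models with non-random potentials have a single mark. -/
structure SpinModel where
  /-- number of nodes in a hyperedge -/
  K : ℕ
  /-- size of the alphabet -/
  q : ℕ
  /-- the marks that select the random potential of a hyperedge -/
  Mark : Type
  [fintypeMark : Fintype Mark]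
  [nonemptyMark : Nonempty Mark]
  /-- the node potential -/
  node : Fin q → ℝ
  /-- the potential of a hyperedge with a given mark -/
  edge : Mark → (Fin K → Fin q) → WithBot ℝ

attribute [instance] SpinModel.fintypeMark SpinModel.nonemptyMark

namespace SpinModel

/-- An instance with `M` hyperedges on the node set `Fin N`: a sequence of `M` directed hyperedges
(elements of `[N]^K`, nodes and hyperedges may repeat), each with its mark. -/
abbrev Inst (m : SpinModel) (N M : ℕ) : Type :=
  Fin M → (Fin m.K → Fin N) × m.Mark

/-- `H(x) = ∑ i, H_i(x_i) + ∑ e, H_e(x_e)`, with values in `{-∞} ∪ ℝ`. -/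
noncomputable def energy (m : SpinModel) {N M : ℕ} (g : m.Inst N M) (x : Fin N → Fin m.q) :
    WithBot ℝ :=
  ∑ i : Fin N, ((m.node (x i) : ℝ) : WithBot ℝ) +
    ∑ j : Fin M, m.edge (g j).2 (fun k => x ((g j).1 k))

end SpinModel

/-- `λ ^ h` for `h` in `{-∞} ∪ ℝ`, where `λ ^ (-∞) = 0`. -/
noncomputable def powBot (lam : ℝ) : WithBot ℝ → ℝ
  | ⊥ => 0
  | (h : ℝ) => lam ^ h

namespace SpinModel

/-- The partition function `Z = ∑ x, λ ^ H(x)`. -/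
noncomputable def partitionFn (m : SpinModel) (lam : ℝ) {N M : ℕ} (g : m.Inst N M) : ℝ :=
  ∑ x : Fin N → Fin m.q, powBot lam (m.energy g x)

/-- An instance is simple if the nodes within each hyperedge are distinct and no two hyperedges
have the same set of nodes. -/
def IsSimple (m : SpinModel) {N M : ℕ} (g : m.Inst N M) : Prop :=
  (∀ j, Function.Injective (g j).1) ∧ Function.Injective (fun j => Set.range (g j).1)

end SpinModel

/-- The uniform distribution on a finite nonempty set `S`; every set is measurable. -/
noncomputable def uniformLaw {Ω : Type} (S : Set Ω) : @Measure Ω ⊤ :=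
  letI : MeasurableSpace Ω := ⊤
  ProbabilityTheory.uniformOn S

namespace SpinModel

/-- The law of the random instance on `G(N, M)`: `M` hyperedges chosen independently and uniformly
from `[N]^K` (with replacement), with independent uniform marks. -/
noncomputable def erLaw (m : SpinModel) (N M : ℕ) : @Measure (m.Inst N M) ⊤ :=
  uniformLaw Set.univ

/-- The law of the random instance on the simple `G(N, M)`: the node sets of the hyperedges are `M`
distinct `K`-element subsets of the nodes, chosen uniformly without replacement; each is listed in
a uniformly random order and carries an independent uniform mark. -/
noncomputable def simpleErLaw (m : SpinModel) (N M : ℕ) : @Measure (m.Inst N M) ⊤ :=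
  uniformLaw {g | m.IsSimple g}

/-- `N⁻¹ log Z(G(N, ⌊cN⌋)) → z(c)` in probability for every `c > 0`, both for the Erdős–Rényi
hypergraph with replacement and for the simple one. -/
def LogPartitionLimit (m : SpinModel) (lam : ℝ) (z : ℝ → ℝ) : Prop :=
  ∀ c : ℝ, 0 < c → ∀ ε : ℝ, 0 < ε →
    Tendsto (fun N : ℕ => m.erLaw N ⌊c * N⌋₊
        {g | ε < |(N : ℝ)⁻¹ * Real.log (m.partitionFn lam g) - z c|}) atTop (𝓝 0) ∧
    Tendsto (fun N : ℕ => m.simpleErLaw N ⌊c * N⌋₊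
        {g | ε < |(N : ℝ)⁻¹ * Real.log (m.partitionFn lam g) - z c|}) atTop (𝓝 0)

/-- Independent set. -/
noncomputable def independentSet : SpinModel where
  K := 2
  q := 2
  Mark := Unit
  node s := if s = 1 then 1 else 0
  edge _ y := if y 0 = 1 ∧ y 1 = 1 then ⊥ else 0

/-- MAX-CUT. -/
noncomputable def maxCut : SpinModel where
  K := 2
  q := 2
  Mark := Unit
  node _ := 0
  edge _ y := if y 0 = y 1 then 0 else 1

/-- Anti-ferromagnetic Ising model with coupling `β` and external field `B`. -/
noncomputable def ising (β B : ℝ) : SpinModel where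
  K := 2
  q := 2
  Mark := Unit
  node s := if s = 1 then B else -B
  edge _ y := if y 0 = y 1 then ((-β : ℝ) : WithBot ℝ) else ((β : ℝ) : WithBot ℝ)

/-- `q`-Coloring. -/
noncomputable def coloring (q : ℕ) : SpinModel where
  K := 2
  q := q
  Mark := Unit
  node _ := 0
  edge _ y := if y 0 = y 1 then 0 else 1

/-- Random K-SAT: the mark is the violating assignment `a` of the clause. -/
noncomputable def kSat (K : ℕ) : SpinModel where
  K := K
  q := 2
  Mark := Fin K → Fin 2
  node _ := 0
  edge a y := if y = a then 0 else 1

/-- Random NAE-K-SAT: the violating assignments of the clause are `a` and `1 - a`. -/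
noncomputable def naeKSat (K : ℕ) : SpinModel where
  K := K
  q := 2
  Mark := Fin K → Fin 2
  node _ := 0
  edge a y := if y = a ∨ y = (fun k => 1 - a k) then 0 else 1

end SpinModel

open scoped BigOperators

/-!
Adding a hyperedge changes `log Z` by a bounded amount (`Interpolable.abs_logZ_cons_sub_le`). For
soft models this is immediate; for independent sets it holds because emptying a node costs only a
factor `lam`, so a node is empty with Gibbs probability at least `1 / (1 + lam)`
(`independentSet_sum_occupied_le`). Hence the variance of `log Z` with `M` independent hyperedges is
`O(M)`, Chebyshev's inequality reduces convergence in probability to convergence of the mean divided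
by `N`, and the limit is Lipschitz in the density. It inherits the monotonicity of `log Z` in the
hyperedges.

The simple hypergraph is the hypergraph with replacement conditioned on being simple. At linear
density that event has probability bounded away from zero (`exists_le_simpleProb`), so statements
with high probability carry over.

The mean converges by the interpolation method. Split the `N = n + n'` nodes into two parts, and
compare a uniform hyperedge with one that lies inside a part chosen with probability proportional to
its size. A hyperedge multiplies the weight by `A * (1 - g)`; expanding `log (1 - ⟨g⟩)` in powers of
the Gibbs mean `⟨g⟩` and writing the `k`-th power as a Gibbs mean over `k` replicas, the mean over
the hyperedge becomes a nonnegative combination of `K`-th powers of averages over the nodes. Since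
`t ↦ t ^ K` is convex on `[0, ∞)`, splitting can only decrease the mean of `log Z`
(`Interpolable.insertAvg_split_le`). Random insertions of hyperedges are commuting operators on
functions of multisets of hyperedges, so all `M` hyperedges can be replaced one by one, and the
binomial theorem evaluates the outcome (`Interpolable.sum_binomial_le_meanLogZ`). Binomial
fluctuations have order `√(min n n')`, so that subtracting a multiple of `√N` from the mean makes it
superadditive, and Fekete's lemma gives the limit.
-/

/-! ### Adding a random element to a multiset -/

/-- The operator on functions of a multiset that averages over the insertion of `j a`, where `a` is
uniformly distributed on `ι`. Powers of it are expectations over several independent insertions. -/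
noncomputable def insertAvg {α ι : Type*} [Fintype ι] (j : ι → α) :
    Module.End ℝ (Multiset α → ℝ) where
  toFun f s := 𝔼 a, f (j a ::ₘ s)
  map_add' f g := by ext s; simp [Finset.expect_add_distrib]
  map_smul' c f := by ext s; simp [Finset.mul_expect]

namespace insertAvg

variable {α β ι κ : Type*} [Fintype ι] [Fintype κ]

theorem apply (j : ι → α) (f : Multiset α → ℝ) (s : Multiset α) :
    insertAvg j f s = 𝔼 a, f (j a ::ₘ s) := rfl

theorem pow_succ_apply (j : ι → α) (M : ℕ) (f : Multiset α → ℝ) (s : Multiset α) :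
    (insertAvg j ^ (M + 1)) f s = 𝔼 a, (insertAvg j ^ M) f (j a ::ₘ s) := by
  rw [pow_succ', Module.End.mul_apply, apply]

theorem commute (j : ι → α) (k : κ → α) : Commute (insertAvg j) (insertAvg k) := by
  refine LinearMap.ext fun f => funext fun s => ?_
  simp only [Module.End.mul_apply, apply]
  rw [Finset.expect_comm]
  simp only [Multiset.cons_swap]

theorem monotone (j : ι → α) : Monotone (insertAvg j) :=
  fun _ _ h _ => Finset.expect_le_expect fun _ _ => h _

theorem pow_const [Nonempty ι] (j : ι → α) (M : ℕ) (c : ℝ) (s : Multiset α) :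
    (insertAvg j ^ M) (fun _ => c) s = c := by
  induction M generalizing s with
  | zero => rfl
  | succ M ih => simp [pow_succ_apply, ih]

/-- Averages of a function whose increments are at most `C` have increments at most `C`. -/
theorem abs_pow_cons_sub_le [Nonempty ι] (j : ι → α) {f : Multiset α → ℝ} {C : ℝ}
    (hf : ∀ a s, |f (a ::ₘ s) - f s| ≤ C) (M : ℕ) (a : α) (s : Multiset α) :
    |(insertAvg j ^ M) f (a ::ₘ s) - (insertAvg j ^ M) f s| ≤ C := by
  induction M generalizing s with
  | zero => exact hf a s
  | succ M ih =>
    rw [pow_succ_apply, pow_succ_apply, ← Finset.expect_sub_distrib]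
    refine (Finset.abs_expect_le _ _).trans
      (Finset.expect_le Finset.univ_nonempty fun b _ => ?_)
    rw [Multiset.cons_swap]
    exact ih _

theorem abs_pow_succ_sub_le [Nonempty ι] (j : ι → α) {f : Multiset α → ℝ} {C : ℝ}
    (hf : ∀ a s, |f (a ::ₘ s) - f s| ≤ C) (M : ℕ) (s : Multiset α) :
    |(insertAvg j ^ (M + 1)) f s - (insertAvg j ^ M) f s| ≤ C := by
  rw [pow_succ_apply,
    ← Fintype.expect_const (ι := ι) ((insertAvg j ^ M) f s), ← Finset.expect_sub_distrib]
  exact (Finset.abs_expect_le _ _).trans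
    (Finset.expect_le Finset.univ_nonempty fun b _ => abs_pow_cons_sub_le j hf M _ _)

theorem abs_pow_sub_pow_le [Nonempty ι] (j : ι → α) {f : Multiset α → ℝ} {C : ℝ}
    (hf : ∀ a s, |f (a ::ₘ s) - f s| ≤ C) (M M' : ℕ) (s : Multiset α) :
    |(insertAvg j ^ M) f s - (insertAvg j ^ M') f s| ≤ C * |(M : ℝ) - M'| := by
  wlog h : M' ≤ M generalizing M M'
  · rw [abs_sub_comm, abs_sub_comm (M : ℝ)]
    exact this M' M (le_of_not_ge h)
  obtain ⟨d, rfl⟩ := Nat.exists_eq_add_of_le h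
  have hd : |((M' + d : ℕ) : ℝ) - M'| = d := by simp
  rw [hd]
  clear hd h
  induction d with
  | zero => simp
  | succ d ih =>
    have := abs_pow_succ_sub_le j hf (M' + d) s
    have h3 := abs_sub_le ((insertAvg j ^ (M' + d + 1)) f s) ((insertAvg j ^ (M' + d)) f s)
      ((insertAvg j ^ M') f s)
    rw [← add_assoc]
    push_cast
    linarith

theorem pow_mono_of_le_cons [Nonempty ι] (j : ι → α) {f : Multiset α → ℝ}
    (hf : ∀ a s, f s ≤ f (a ::ₘ s)) (s : Multiset α) :
    Monotone fun M => (insertAvg j ^ M) f s := by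
  refine monotone_nat_of_le_succ fun M => ?_
  induction M generalizing s with
  | zero =>
    rw [pow_succ_apply]
    exact Finset.le_expect Finset.univ_nonempty fun a _ => hf _ _
  | succ M ih =>
    rw [pow_succ_apply, pow_succ_apply]
    exact Finset.expect_le_expect fun a _ => ih _

theorem pow_anti_of_cons_le [Nonempty ι] (j : ι → α) {f : Multiset α → ℝ}
    (hf : ∀ a s, f (a ::ₘ s) ≤ f s) (s : Multiset α) :
    Antitone fun M => (insertAvg j ^ M) f s := by
  intro M M' h
  have := pow_mono_of_le_cons j (f := -f) (fun a s => by simpa using hf a s) s h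
  simpa using this

/-- The variance of a function with increments at most `C`, after `M` independent random
insertions, is at most `M * C ^ 2`: conditioning on the first insertion splits off a variance of
at most `C ^ 2`. -/
theorem pow_sq_sub_sq_le [Nonempty ι] (j : ι → α) {f : Multiset α → ℝ} {C : ℝ}
    (hf : ∀ a s, |f (a ::ₘ s) - f s| ≤ C) (M : ℕ) (s : Multiset α) :
    (insertAvg j ^ M) (fun t => f t ^ 2) s - (insertAvg j ^ M) f s ^ 2 ≤ M * C ^ 2 := by
  induction M generalizing s with
  | zero => simp
  | succ M ih =>
    set h : ι → ℝ := fun a => (insertAvg j ^ M) f (j a ::ₘ s) with hh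
    set h0 : ℝ := (insertAvg j ^ M) f s
    have h1 : (insertAvg j ^ (M + 1)) (fun t => f t ^ 2) s ≤ 𝔼 a, (h a ^ 2 + M * C ^ 2) := by
      rw [pow_succ_apply]
      refine Finset.expect_le_expect fun a _ => ?_
      have := ih (j a ::ₘ s)
      simp only [hh]
      linarith
    have h2 : 𝔼 a, (h a - h0) ^ 2 ≤ C ^ 2 := by
      refine Finset.expect_le Finset.univ_nonempty fun a _ => ?_
      have := abs_pow_cons_sub_le j hf M (j a) s
      exact sq_le_sq' (neg_le_of_abs_le this) (le_of_abs_le this)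
    have h3 : 𝔼 a, (h a - h0) ^ 2 = 𝔼 a, h a ^ 2 - 2 * h0 * 𝔼 a, h a + h0 ^ 2 := by
      rw [Finset.mul_expect, ← Fintype.expect_const (ι := ι) (h0 ^ 2),
        ← Finset.expect_sub_distrib, ← Finset.expect_add_distrib]
      refine Finset.expect_congr rfl fun a _ => ?_
      ring
    rw [Finset.expect_add_distrib, Fintype.expect_const] at h1
    rw [pow_succ_apply j M f]
    push_cast
    nlinarith [sq_nonneg (𝔼 a, h a - h0)]

/-- If replacing one insertion by another kind of insertion decreases the average of `f`, then so
does replacing `M` of them, because the two kinds of insertions commute. -/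
theorem pow_apply_le_pow_apply {S T : Module.End ℝ (Multiset α → ℝ)} (hST : Commute S T)
    (hS : Monotone S) (hT : Monotone T) {f : Multiset α → ℝ} (h : S f ≤ T f) (M : ℕ) :
    (S ^ M) f ≤ (T ^ M) f := by
  induction M with
  | zero => exact le_rfl
  | succ M ih =>
    have hTM : Monotone (T ^ M) := by
      rw [Module.End.coe_pow]
      exact hT.iterate M
    calc (S ^ (M + 1)) f = S ((S ^ M) f) := by rw [pow_succ', Module.End.mul_apply]
      _ ≤ S ((T ^ M) f) := hS ih
      _ = (T ^ M) (S f) := by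
        rw [← Module.End.mul_apply, ← Module.End.mul_apply, (hST.pow_right M).eq]
      _ ≤ (T ^ M) (T f) := hTM h
      _ = (T ^ (M + 1)) f := by rw [pow_succ, Module.End.mul_apply]

theorem pow_map_apply (j : ι → α) (M : ℕ) (f : Multiset α → ℝ) (s : Multiset ι)
    (t : Multiset α) :
    (insertAvg j ^ M) f (s.map j + t) = (insertAvg id ^ M) (fun s => f (s.map j + t)) s := by
  induction M generalizing s with
  | zero => rfl
  | succ M ih =>
    rw [pow_succ_apply, pow_succ_apply]
    refine Finset.expect_congr rfl fun a _ => ?_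
    rw [← ih, id, Multiset.map_cons, Multiset.cons_add]

theorem pow_eq_expect_fin (M : ℕ) (f : Multiset ι → ℝ) (s : Multiset ι) :
    (insertAvg id ^ M) f s = 𝔼 g : Fin M → ι, f (Finset.univ.val.map g + s) := by
  induction M generalizing s with
  | zero => simp
  | succ M ih =>
    rw [pow_succ_apply, ← Fintype.expect_equiv (Fin.consEquiv fun _ => ι)
      (fun p => f (Finset.univ.val.map p.2 + p.1 ::ₘ s)), ← Finset.univ_product_univ,
      Finset.expect_product]
    · simp [ih]
    · rintro ⟨a, g⟩
      congr 1
      simp only [Fin.univ_succ, Function.comp_def, Fin.consEquiv, Finset.cons_val, Finset.map_val,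
        Multiset.map_cons, Multiset.map_map, Equiv.coe_fn_mk, Fin.cons_zero, Multiset.cons_add,
        Function.Embedding.coeFn_mk, Fin.cons_succ, Multiset.add_cons]

end insertAvg

/-! ### Averages over finite types -/

theorem expect_fin_add {n n' : ℕ} (hn : 0 < n) (hn' : 0 < n') (f : Fin (n + n') → ℝ) :
    𝔼 i, f i = (n / (n + n') : ℝ) * 𝔼 i, f (Fin.castAdd n' i)
      + (1 - n / (n + n') : ℝ) * 𝔼 i, f (Fin.natAdd n i) := by
  simp only [Fintype.expect_eq_sum_div_card, Fin.sum_univ_add, Fintype.card_fin]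
  have : (0 : ℝ) < n := by exact_mod_cast hn
  have : (0 : ℝ) < n' := by exact_mod_cast hn'
  push_cast
  field_simp
  ring

theorem hasSum_expect_log {ι : Type*} [Fintype ι] {t : ι → ℝ} (h0 : ∀ i, 0 ≤ t i)
    (h1 : ∀ i, t i < 1) :
    HasSum (fun k : ℕ => (𝔼 i, t i ^ (k + 1)) / ((k : ℝ) + 1)) (-𝔼 i, Real.log (1 - t i)) := by
  have h2 : HasSum (fun k : ℕ => (∑ i, t i ^ (k + 1) / ((k : ℝ) + 1)) / Fintype.card ι)
      ((∑ i, -Real.log (1 - t i)) / Fintype.card ι) :=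
    (hasSum_sum fun i _ => Real.hasSum_pow_div_log_of_abs_lt_one
      (by rw [abs_of_nonneg (h0 i)]; exact h1 i)).div_const _
  convert h2 using 1
  · ext k
    rw [Fintype.expect_eq_sum_div_card, ← Finset.sum_div]
    ring
  · rw [Fintype.expect_eq_sum_div_card, Finset.sum_neg_distrib, neg_div]

namespace SpinModel

/-! ### Partition functions of multisets of hyperedges -/

/-- A directed hyperedge on `Fin N` together with its mark. -/
abbrev Edge (m : SpinModel) (N : ℕ) : Type := (Fin m.K → Fin N) × m.Mark

/-- The hyperedge obtained by relabelling the nodes along `h`. -/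
def Edge.map {m : SpinModel} {n N : ℕ} (h : Fin n → Fin N) (e : m.Edge n) : m.Edge N :=
  (h ∘ e.1, e.2)

/-- The Boltzmann weight of a configuration on the hypergraph with hyperedges `s`. Orderings of the
hyperedges are irrelevant for it, which is why `s` is a multiset. -/
noncomputable def weight (m : SpinModel) (lam : ℝ) {N : ℕ} (s : Multiset (m.Edge N))
    (x : Fin N → Fin m.q) : ℝ :=
  (∏ i, lam ^ m.node (x i)) * (s.map fun e => powBot lam (m.edge e.2 (x ∘ e.1))).prod

/-- The logarithm of the partition function of the hypergraph with hyperedges `s`. -/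
noncomputable def logZ (m : SpinModel) (lam : ℝ) {N : ℕ} (s : Multiset (m.Edge N)) : ℝ :=
  Real.log (∑ x, m.weight lam s x)

/-- `E log Z` for `M` independent uniform marked hyperedges on `N` nodes. -/
noncomputable def meanLogZ (m : SpinModel) (lam : ℝ) (N M : ℕ) : ℝ :=
  (insertAvg (id : m.Edge N → m.Edge N) ^ M) (m.logZ lam) 0

/-- The structure that makes the interpolation work. A hyperedge multiplies the weight by
`A * (1 - g)`, the Gibbs mean of `g` stays bounded away from `1`, and the mean over the mark of a
product of copies of `g`, evaluated at several replicas of a configuration, is a nonnegative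
combination of products over the `K` nodes of a nonnegative function of the replicated spin. -/
structure Interpolable (m : SpinModel) (lam A α : ℝ)
    (g : m.Mark → (Fin m.K → Fin m.q) → ℝ) : Prop where
  lam_pos : 0 < lam
  two_le_K : 2 ≤ m.K
  q_pos : 0 < m.q
  A_pos : 0 < A
  α_lt_one : α < 1
  g_nonneg : ∀ a y, 0 ≤ g a y
  powBot_edge : ∀ a y, powBot lam (m.edge a y) = A * (1 - g a y)
  gibbs_le : ∀ (N : ℕ) (s : Multiset (m.Edge N)) (e : m.Edge N),
    ∑ x, m.weight lam s x * g e.2 (x ∘ e.1) ≤ α * ∑ x, m.weight lam s x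
  replica : ∀ k : ℕ, ∃ (S : Type) (_ : Fintype S) (c : ℝ) (φ : S → (Fin k → Fin m.q) → ℝ),
    0 ≤ c ∧ (∀ s v, 0 ≤ φ s v) ∧ ∀ y : Fin k → Fin m.K → Fin m.q,
      ∑ a, ∏ l, g a (y l) = c * ∑ s, ∏ j, φ s fun l => y l j

theorem powBot_nonneg {lam : ℝ} (hlam : 0 ≤ lam) (h : WithBot ℝ) : 0 ≤ powBot lam h := by
  cases h with
  | bot => exact le_rfl
  | coe h => exact Real.rpow_nonneg hlam h

theorem powBot_add {lam : ℝ} (hlam : 0 < lam) (a b : WithBot ℝ) :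
    powBot lam (a + b) = powBot lam a * powBot lam b := by
  cases a with
  | bot => simp [powBot]
  | coe a =>
    cases b with
    | bot => simp [powBot]
    | coe b => exact Real.rpow_add hlam a b

theorem powBot_sum {lam : ℝ} (hlam : 0 < lam) {ι : Type*} (s : Finset ι) (f : ι → WithBot ℝ) :
    powBot lam (∑ i ∈ s, f i) = ∏ i ∈ s, powBot lam (f i) := by
  classical
  induction s using Finset.induction_on with
  | empty => exact Real.rpow_zero lam
  | insert a s ha ih => rw [Finset.sum_insert ha, Finset.prod_insert ha, powBot_add hlam, ih]

theorem log_partitionFn (m : SpinModel) {lam : ℝ} (hlam : 0 < lam) {N M : ℕ} (G : m.Inst N M) :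
    Real.log (m.partitionFn lam G) = m.logZ lam (Finset.univ.val.map G) := by
  unfold partitionFn logZ weight energy
  congr 1
  refine Finset.sum_congr rfl fun x _ => ?_
  rw [powBot_add hlam, powBot_sum hlam, powBot_sum hlam, Multiset.map_map]
  rfl

theorem weight_cons (m : SpinModel) (lam : ℝ) {N : ℕ} (e : m.Edge N) (s : Multiset (m.Edge N))
    (x : Fin N → Fin m.q) :
    m.weight lam (e ::ₘ s) x = powBot lam (m.edge e.2 (x ∘ e.1)) * m.weight lam s x := by
  simp only [weight, Multiset.map_cons, Multiset.prod_cons]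
  ring

theorem weight_nonneg (m : SpinModel) {lam : ℝ} (hlam : 0 < lam) {N : ℕ}
    (s : Multiset (m.Edge N)) (x : Fin N → Fin m.q) : 0 ≤ m.weight lam s x := by
  refine mul_nonneg (Finset.prod_nonneg fun i _ => (Real.rpow_pos_of_pos hlam _).le)
    (Multiset.prod_nonneg fun a ha => ?_)
  obtain ⟨e, -, rfl⟩ := Multiset.mem_map.1 ha
  exact powBot_nonneg hlam.le _

theorem sum_weight_append (m : SpinModel) (lam : ℝ) {n n' : ℕ} (s : Multiset (m.Edge n))
    (t : Multiset (m.Edge n')) :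
    ∑ x, m.weight lam (s.map (Edge.map (Fin.castAdd n')) + t.map (Edge.map (Fin.natAdd n))) x
      = (∑ x, m.weight lam s x) * ∑ x, m.weight lam t x := by
  rw [Fintype.sum_mul_sum, ← Fintype.sum_prod_type',
    ← (Fin.appendEquiv (α := Fin m.q) n n').sum_comp]
  refine Finset.sum_congr rfl fun p _ => ?_
  simp only [weight, Fin.appendEquiv, Equiv.coe_fn_mk, Fin.prod_univ_add, Fin.append_left,
    Fin.append_right, Multiset.map_add, Multiset.map_map, Multiset.prod_add, Function.comp_def,
    Edge.map]
  ring

theorem nonempty_edge (m : SpinModel) {N : ℕ} (hN : 0 < N) : Nonempty (m.Edge N) :=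
  ⟨fun _ => ⟨0, hN⟩, Classical.arbitrary _⟩

namespace Interpolable

variable {m : SpinModel} {lam A α : ℝ} {g : m.Mark → (Fin m.K → Fin m.q) → ℝ}

theorem sum_weight_pos (h : m.Interpolable lam A α g) {N : ℕ} (s : Multiset (m.Edge N)) :
    0 < ∑ x, m.weight lam s x := by
  induction s using Multiset.induction_on with
  | empty =>
    have : Nonempty (Fin m.q) := ⟨⟨0, h.q_pos⟩⟩
    refine Finset.sum_pos (fun x _ => ?_) Finset.univ_nonempty
    simpa [weight] using Finset.prod_pos fun i _ => Real.rpow_pos_of_pos h.lam_pos (m.node (x i))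
  | cons e s ih =>
    have h1 := h.gibbs_le N s e
    have h2 : ∑ x, m.weight lam (e ::ₘ s) x
        = A * (∑ x, m.weight lam s x - ∑ x, m.weight lam s x * g e.2 (x ∘ e.1)) := by
      rw [← Finset.sum_sub_distrib, Finset.mul_sum]
      refine Finset.sum_congr rfl fun x _ => ?_
      rw [weight_cons, h.powBot_edge]
      ring
    rw [h2]
    refine mul_pos h.A_pos ?_
    nlinarith [h.α_lt_one]

end Interpolable

/-- The Gibbs mean of `g` at the hyperedge `e`, for the hypergraph with hyperedges `s`. -/
noncomputable def gibbsMean (m : SpinModel) (lam : ℝ) (g : m.Mark → (Fin m.K → Fin m.q) → ℝ)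
    {N : ℕ} (s : Multiset (m.Edge N)) (e : m.Edge N) : ℝ :=
  ∑ x, m.weight lam s x / (∑ x, m.weight lam s x) * g e.2 (x ∘ e.1)

theorem gibbsMean_eq (m : SpinModel) (lam : ℝ) (g : m.Mark → (Fin m.K → Fin m.q) → ℝ) {N : ℕ}
    (s : Multiset (m.Edge N)) (e : m.Edge N) :
    m.gibbsMean lam g s e =
      (∑ x, m.weight lam s x * g e.2 (x ∘ e.1)) / ∑ x, m.weight lam s x := by
  rw [Finset.sum_div]
  exact Finset.sum_congr rfl fun x _ => div_mul_eq_mul_div _ _ _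

/-- Insertion of a uniform hyperedge inside one of the two parts of `n` and `n'` nodes, where the
part is chosen with probability proportional to its size. -/
noncomputable def splitAvg (m : SpinModel) (n n' : ℕ) :
    Module.End ℝ (Multiset (m.Edge (n + n')) → ℝ) :=
  (n / (n + n') : ℝ) • insertAvg (Edge.map (Fin.castAdd n'))
    + (1 - n / (n + n') : ℝ) • insertAvg (Edge.map (Fin.natAdd n))

namespace Interpolable

variable {m : SpinModel} {lam A α : ℝ} {g : m.Mark → (Fin m.K → Fin m.q) → ℝ}

theorem gibbsMean_nonneg (h : m.Interpolable lam A α g) {N : ℕ} (s : Multiset (m.Edge N))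
    (e : m.Edge N) : 0 ≤ m.gibbsMean lam g s e :=
  Finset.sum_nonneg fun x _ => mul_nonneg
    (div_nonneg (weight_nonneg m h.lam_pos s x) (h.sum_weight_pos s).le) (h.g_nonneg _ _)

theorem gibbsMean_le (h : m.Interpolable lam A α g) {N : ℕ} (s : Multiset (m.Edge N))
    (e : m.Edge N) : m.gibbsMean lam g s e ≤ α := by
  rw [gibbsMean_eq, div_le_iff₀ (h.sum_weight_pos s)]
  exact h.gibbs_le N s e

theorem logZ_cons (h : m.Interpolable lam A α g) {N : ℕ} (e : m.Edge N)
    (s : Multiset (m.Edge N)) :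
    m.logZ lam (e ::ₘ s) =
      m.logZ lam s + Real.log A + Real.log (1 - m.gibbsMean lam g s e) := by
  have hZ := h.sum_weight_pos s
  have h1 : 0 < 1 - m.gibbsMean lam g s e := by linarith [h.gibbsMean_le s e, h.α_lt_one]
  have h2 : ∑ x, m.weight lam (e ::ₘ s) x
      = (∑ x, m.weight lam s x) * A * (1 - m.gibbsMean lam g s e) := by
    rw [gibbsMean_eq]
    field_simp
    rw [← Finset.sum_sub_distrib, Finset.mul_sum]
    refine Finset.sum_congr rfl fun x _ => ?_
    rw [weight_cons, h.powBot_edge]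
    ring
  rw [logZ, logZ, h2, Real.log_mul (mul_pos hZ h.A_pos).ne' h1.ne',
    Real.log_mul hZ.ne' h.A_pos.ne']

/-- Adding a hyperedge changes `log Z` by a bounded amount. -/
theorem abs_logZ_cons_sub_le (h : m.Interpolable lam A α g) {N : ℕ} (e : m.Edge N)
    (s : Multiset (m.Edge N)) :
    |m.logZ lam (e ::ₘ s) - m.logZ lam s| ≤ |Real.log A| - Real.log (1 - α) := by
  have h0 := h.gibbsMean_nonneg s e
  have h1 := h.gibbsMean_le s e
  have h2 := h.α_lt_one
  have h3 : Real.log (1 - α) ≤ Real.log (1 - m.gibbsMean lam g s e) :=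
    Real.log_le_log (by linarith) (by linarith)
  have h4 : Real.log (1 - m.gibbsMean lam g s e) ≤ 0 :=
    Real.log_nonpos (by linarith) (by linarith)
  rw [h.logZ_cons, add_assoc, add_sub_cancel_left, abs_le]
  constructor <;> linarith [neg_abs_le (Real.log A), le_abs_self (Real.log A)]

/-! ### The interpolation inequality -/

/-- Powers of the Gibbs mean are replicated Gibbs averages; averaging over a uniform hyperedge
whose nodes lie in the image of `j` then yields `K`-th powers of node averages. -/
theorem expect_gibbsMean_pow {n N : ℕ} (j : Fin n → Fin N) (s : Multiset (m.Edge N)) {k : ℕ}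
    {S : Type} [Fintype S] {c : ℝ} {φ : S → (Fin k → Fin m.q) → ℝ}
    (hφ : ∀ y : Fin k → Fin m.K → Fin m.q,
      ∑ a, ∏ l, g a (y l) = c * ∑ s, ∏ j, φ s fun l => y l j) :
    𝔼 e : m.Edge n, m.gibbsMean lam g s (e.map j) ^ k =
      ∑ X : Fin k → Fin N → Fin m.q,
        (∏ l, m.weight lam s (X l) / (∑ x, m.weight lam s x)) *
          (c / Fintype.card m.Mark * ∑ r, (𝔼 i, φ r fun l => X l (j i)) ^ m.K) := by
  simp only [gibbsMean, Fintype.sum_pow, Finset.prod_mul_distrib, Edge.map]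
  rw [Finset.expect_sum_comm]
  refine Finset.sum_congr rfl fun X _ => ?_
  rw [← Finset.mul_expect]
  congr 1
  rw [← Finset.univ_product_univ, Finset.expect_product]
  have h1 : ∀ v : Fin m.K → Fin n,
      𝔼 a : m.Mark, ∏ l, g a (X l ∘ j ∘ v)
        = c / Fintype.card m.Mark * ∑ r, ∏ i, φ r fun l => X l (j (v i)) := by
    intro v
    rw [Fintype.expect_eq_sum_div_card, hφ]
    simp only [Function.comp_apply]
    ring
  simp only [h1]
  rw [← Finset.mul_expect, Finset.expect_sum_comm]
  congr 1
  refine Finset.sum_congr rfl fun r _ => ?_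
  rw [Finset.expect_pow, Fintype.piFinset_univ]

/-- Convexity of `t ↦ t ^ K` shows that splitting the nodes into two parts increases the moments
of the Gibbs mean. -/
theorem expect_gibbsMean_pow_le (h : m.Interpolable lam A α g) {n n' : ℕ} (hn : 0 < n)
    (hn' : 0 < n') (s : Multiset (m.Edge (n + n'))) (k : ℕ) :
    𝔼 e, m.gibbsMean lam g s e ^ k ≤
      (n / (n + n') : ℝ) * 𝔼 e : m.Edge n, m.gibbsMean lam g s (e.map (Fin.castAdd n')) ^ k
      + (1 - n / (n + n') : ℝ) *
        𝔼 e : m.Edge n', m.gibbsMean lam g s (e.map (Fin.natAdd n)) ^ k := by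
  obtain ⟨S, _, c, φ, hc, hφ0, hφ⟩ := h.replica k
  have hid := expect_gibbsMean_pow (lam := lam) id s hφ
  simp only [Edge.map, Function.id_comp, Prod.mk.eta, id] at hid
  rw [hid, expect_gibbsMean_pow _ s hφ, expect_gibbsMean_pow _ s hφ, Finset.mul_sum,
    Finset.mul_sum, ← Finset.sum_add_distrib]
  refine Finset.sum_le_sum fun X _ => ?_
  have hπ : 0 ≤ ∏ l, m.weight lam s (X l) / (∑ x, m.weight lam s x) :=
    Finset.prod_nonneg fun l _ =>
      div_nonneg (weight_nonneg m h.lam_pos s _) (h.sum_weight_pos s).le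
  have hcM : 0 ≤ c / Fintype.card m.Mark := by positivity
  have hn0 : (0 : ℝ) < n := by exact_mod_cast hn
  have hn0' : (0 : ℝ) < n' := by exact_mod_cast hn'
  have hp0 : (0 : ℝ) ≤ n / (n + n') := by positivity
  have hp1 : (0 : ℝ) ≤ 1 - n / (n + n') := by
    rw [sub_nonneg, div_le_one (by positivity)]
    linarith
  have key : ∀ r, (𝔼 i, φ r fun l => X l i) ^ m.K ≤
      (n / (n + n') : ℝ) * (𝔼 i, φ r fun l => X l (Fin.castAdd n' i)) ^ m.K
      + (1 - n / (n + n') : ℝ) * (𝔼 i, φ r fun l => X l (Fin.natAdd n i)) ^ m.K := by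
    intro r
    rw [expect_fin_add hn hn']
    exact (convexOn_pow m.K).2 (Finset.expect_nonneg fun i _ => hφ0 r _)
      (Finset.expect_nonneg fun i _ => hφ0 r _) hp0 hp1 (by ring)
  have := Finset.sum_le_sum fun r (_ : r ∈ Finset.univ) => key r
  rw [Finset.sum_add_distrib, ← Finset.mul_sum, ← Finset.mul_sum] at this
  calc _ ≤ _ := mul_le_mul_of_nonneg_left (mul_le_mul_of_nonneg_left this hcM) hπ
    _ = _ := by ring

/-- A uniform hyperedge on all nodes gives at least as large a mean of `log Z` as a hyperedge inside
one of two parts, chosen with probability proportional to its size. -/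
theorem insertAvg_split_le (h : m.Interpolable lam A α g) {n n' : ℕ} (hn : 0 < n)
    (hn' : 0 < n') :
    splitAvg m n n' (m.logZ lam)
      ≤ insertAvg (id : m.Edge (n + n') → m.Edge (n + n')) (m.logZ lam) := by
  intro s
  have : Nonempty (m.Edge n) := nonempty_edge m hn
  have : Nonempty (m.Edge n') := nonempty_edge m hn'
  have : Nonempty (m.Edge (n + n')) := nonempty_edge m (by omega)
  have h0 := h.gibbsMean_nonneg s
  have h1 : ∀ e, m.gibbsMean lam g s e < 1 := fun e => (h.gibbsMean_le s e).trans_lt h.α_lt_one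
  have s1 := hasSum_expect_log h0 h1
  have s2 := hasSum_expect_log (fun e => h0 (Edge.map (Fin.castAdd n') e)) fun e => h1 _
  have s3 := hasSum_expect_log (fun e => h0 (Edge.map (Fin.natAdd n) e)) fun e => h1 _
  have key := hasSum_le (fun k => ?_) s1
    ((s2.mul_left (n / (n + n') : ℝ)).add (s3.mul_left (1 - n / (n + n') : ℝ)))
  · simp only [splitAvg, LinearMap.add_apply, LinearMap.smul_apply, Pi.add_apply, Pi.smul_apply,
      insertAvg.apply, h.logZ_cons, Finset.expect_add_distrib, Fintype.expect_const, smul_eq_mul,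
      id]
    linarith
  · have := h.expect_gibbsMean_pow_le hn hn' s (k + 1)
    calc _ ≤ _ := div_le_div_of_nonneg_right this (by positivity)
      _ = _ := by ring

end Interpolable

end SpinModel

/-! ### Binomial deviations -/

theorem sum_binomial_weight (M : ℕ) (p : ℝ) :
    ∑ k ∈ Finset.range (M + 1), p ^ k * (1 - p) ^ (M - k) * (M.choose k : ℝ) = 1 := by
  rw [← add_pow]
  simp

/-- The mean absolute deviation of a binomial variable is controlled by its variance, via
`|t| ≤ (t ^ 2 / σ + σ) / 2`. -/
theorem sum_binomial_abs_sub_le (M : ℕ) {p σ : ℝ} (hp0 : 0 ≤ p) (hp1 : p ≤ 1) (hσ : 0 < σ) :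
    ∑ k ∈ Finset.range (M + 1), p ^ k * (1 - p) ^ (M - k) * (M.choose k : ℝ) * |k - M * p|
      ≤ (M * p * (1 - p) / σ + σ) / 2 := by
  have hvar : ∑ k ∈ Finset.range (M + 1),
      p ^ k * (1 - p) ^ (M - k) * (M.choose k : ℝ) * (k - M * p) ^ 2 = M * p * (1 - p) := by
    have := congrArg (Polynomial.eval p) (bernsteinPolynomial.variance ℝ M)
    simp only [Polynomial.eval_finsetSum, bernsteinPolynomial, Polynomial.eval_mul,
      Polynomial.eval_pow, Polynomial.eval_sub, Polynomial.eval_X, Polynomial.eval_natCast,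
      Polynomial.eval_one, nsmul_eq_mul] at this
    rw [← this]
    exact Finset.sum_congr rfl fun k _ => by ring
  calc ∑ k ∈ Finset.range (M + 1), p ^ k * (1 - p) ^ (M - k) * (M.choose k : ℝ) * |k - M * p|
      ≤ ∑ k ∈ Finset.range (M + 1), p ^ k * (1 - p) ^ (M - k) * (M.choose k : ℝ) *
          (((k - M * p) ^ 2 / σ + σ) / 2) := by
        refine Finset.sum_le_sum fun k _ => mul_le_mul_of_nonneg_left ?_ ?_
        · have h1 : 0 ≤ (|k - M * p| - σ) ^ 2 / σ := by positivity
          have h2 : (|k - M * p| - σ) ^ 2 / σ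
              = (k - M * p) ^ 2 / σ + σ - 2 * |k - M * p| := by
            rw [sub_sq, sq_abs]
            field_simp
            ring
          linarith
        · have : 0 ≤ 1 - p := by linarith
          positivity
    _ = ((∑ k ∈ Finset.range (M + 1),
          p ^ k * (1 - p) ^ (M - k) * (M.choose k : ℝ) * (k - M * p) ^ 2) / σ
          + σ * ∑ k ∈ Finset.range (M + 1), p ^ k * (1 - p) ^ (M - k) * (M.choose k : ℝ)) / 2 := by
        rw [Finset.sum_div, Finset.mul_sum, ← Finset.sum_add_distrib, Finset.sum_div]
        exact Finset.sum_congr rfl fun k _ => by ring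
    _ = (M * p * (1 - p) / σ + σ) / 2 := by rw [hvar, sum_binomial_weight, mul_one]

theorem sqrt_add_le_sqrt_add_half_sqrt {a b : ℝ} (ha : 0 ≤ a) (hab : a ≤ b) :
    √(a + b) ≤ √b + √a / 2 := by
  have hb := ha.trans hab
  refine Real.sqrt_le_iff.2 ⟨by positivity, ?_⟩
  nlinarith [Real.sq_sqrt ha, Real.sq_sqrt hb, Real.sqrt_nonneg a, Real.sqrt_le_sqrt hab]

/-- The strict subadditivity of `√` that absorbs errors of order `√(min a b)`. -/
theorem half_sqrt_min_le (a b : ℝ) (ha : 0 ≤ a) (hb : 0 ≤ b) :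
    √(min a b) / 2 ≤ √a + √b - √(a + b) := by
  rcases le_total a b with h | h
  · rw [min_eq_left h]
    linarith [sqrt_add_le_sqrt_add_half_sqrt ha h]
  · rw [min_eq_right h, add_comm a b]
    linarith [sqrt_add_le_sqrt_add_half_sqrt hb h]

theorem abs_floor_mul_sub_le {c : ℝ} (hc : 0 ≤ c) (n : ℕ) : |(⌊c * n⌋₊ : ℝ) - c * n| ≤ 1 := by
  have h1 := Nat.floor_le (by positivity : 0 ≤ c * n)
  have h2 := Nat.lt_floor_add_one (c * n)
  rw [abs_le]
  constructor <;> linarith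

namespace SpinModel

/-! ### Superadditivity and the limit of the mean -/

theorem meanLogZ_zero_right (m : SpinModel) (lam : ℝ) (N : ℕ) :
    m.meanLogZ lam N 0 = N * Real.log (∑ s, lam ^ m.node s) := by
  have : m.meanLogZ lam N 0 = m.logZ lam (0 : Multiset (m.Edge N)) := rfl
  rw [this, logZ, ← Real.log_pow, Fintype.sum_pow]
  simp [weight]

namespace Interpolable

variable {m : SpinModel} {lam A α : ℝ} {g : m.Mark → (Fin m.K → Fin m.q) → ℝ}

theorem logZ_append (h : m.Interpolable lam A α g) {n n' : ℕ} (s : Multiset (m.Edge n))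
    (t : Multiset (m.Edge n')) :
    m.logZ lam (s.map (Edge.map (Fin.castAdd n')) + t.map (Edge.map (Fin.natAdd n)))
      = m.logZ lam s + m.logZ lam t := by
  rw [logZ, sum_weight_append, Real.log_mul (h.sum_weight_pos s).ne' (h.sum_weight_pos t).ne']
  rfl

/-- Hyperedges inserted in the two parts separately contribute additively to the mean of `log Z`. -/
theorem insertAvg_parts_eq (h : m.Interpolable lam A α g) {n n' : ℕ} (hn : 0 < n)
    (hn' : 0 < n') (k l : ℕ) :
    (insertAvg (Edge.map (m := m) (Fin.castAdd n')) ^ k)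
      ((insertAvg (Edge.map (Fin.natAdd n)) ^ l) (m.logZ lam)) 0
        = m.meanLogZ lam n k + m.meanLogZ lam n' l := by
  have : Nonempty (m.Edge n) := nonempty_edge m hn
  have : Nonempty (m.Edge n') := nonempty_edge m hn'
  have h1 := insertAvg.pow_map_apply (Edge.map (Fin.castAdd n')) k
    ((insertAvg (Edge.map (Fin.natAdd n)) ^ l) (m.logZ lam)) 0 0
  have h2 : ∀ s : Multiset (m.Edge n), (insertAvg (Edge.map (Fin.natAdd n)) ^ l) (m.logZ lam)
      (s.map (Edge.map (Fin.castAdd n')) + 0) = m.logZ lam s + m.meanLogZ lam n' l := by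
    intro s
    have h3 := insertAvg.pow_map_apply (Edge.map (Fin.natAdd n)) l (m.logZ lam) 0
      (s.map (Edge.map (Fin.castAdd n')))
    rw [Multiset.map_zero, zero_add] at h3
    rw [add_zero, h3]
    have h4 : (fun t : Multiset (m.Edge n') => m.logZ lam
        (t.map (Edge.map (Fin.natAdd n)) + s.map (Edge.map (Fin.castAdd n'))))
        = (fun _ => m.logZ lam s) + m.logZ lam := by
      ext t
      rw [add_comm (Multiset.map _ t), h.logZ_append]
      rfl
    rw [h4, map_add, Pi.add_apply, insertAvg.pow_const]
    rfl
  rw [Multiset.map_zero, add_zero] at h1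
  simp only [h2] at h1
  rw [h1]
  have h5 : (fun s : Multiset (m.Edge n) => m.logZ lam s + m.meanLogZ lam n' l)
      = m.logZ lam + fun _ => m.meanLogZ lam n' l := rfl
  rw [h5, map_add, Pi.add_apply, insertAvg.pow_const]
  rfl

/-- Interpolation: `E log Z` on `n + n'` nodes is at least its value on two disjoint hypergraphs
with `n` and `n'` nodes that share the hyperedges binomially. -/
theorem sum_binomial_le_meanLogZ (h : m.Interpolable lam A α g) {n n' : ℕ} (hn : 0 < n)
    (hn' : 0 < n') (M : ℕ) :
    ∑ k ∈ Finset.range (M + 1),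
      (n / (n + n') : ℝ) ^ k * (1 - n / (n + n') : ℝ) ^ (M - k) * (M.choose k : ℝ) *
        (m.meanLogZ lam n k + m.meanLogZ lam n' (M - k)) ≤ m.meanLogZ lam (n + n') M := by
  have hcomm : Commute (splitAvg m n n') (insertAvg id) :=
    ((insertAvg.commute _ _).smul_left _).add_left ((insertAvg.commute _ _).smul_left _)
  have hn0 : (0 : ℝ) < n := by exact_mod_cast hn
  have hn0' : (0 : ℝ) < n' := by exact_mod_cast hn'
  have hp0 : (0 : ℝ) ≤ n / (n + n') := by positivity
  have hp1 : (0 : ℝ) ≤ 1 - n / (n + n') := by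
    rw [sub_nonneg, div_le_one (by positivity)]
    linarith
  have hmono : Monotone (splitAvg m n n') := fun f f' hf s =>
    add_le_add (mul_le_mul_of_nonneg_left (insertAvg.monotone _ hf s) hp0)
      (mul_le_mul_of_nonneg_left (insertAvg.monotone _ hf s) hp1)
  have key := insertAvg.pow_apply_le_pow_apply hcomm hmono (insertAvg.monotone _)
    (h.insertAvg_split_le hn hn') M 0
  refine le_of_eq_of_le ?_ key
  rw [splitAvg, Commute.add_pow
    (((insertAvg.commute _ _).smul_left _).smul_right _), LinearMap.sum_apply, Finset.sum_apply]
  refine Finset.sum_congr rfl fun k _ => ?_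
  rw [← h.insertAvg_parts_eq hn hn', smul_pow, smul_pow, smul_mul_smul_comm,
    ← nsmul_eq_mul', ← nsmul_eq_mul']
  simp only [LinearMap.smul_apply, Pi.smul_apply, smul_eq_mul, Module.End.mul_apply]
  rw [nsmul_eq_mul, nsmul_eq_mul]
  ring

theorem abs_meanLogZ_sub_le (h : m.Interpolable lam A α g) {N : ℕ} (hN : 0 < N) (M M' : ℕ) :
    |m.meanLogZ lam N M - m.meanLogZ lam N M'|
      ≤ (|Real.log A| - Real.log (1 - α)) * |(M : ℝ) - M'| :=
  have : Nonempty (m.Edge N) := nonempty_edge m hN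
  insertAvg.abs_pow_sub_pow_le _ (fun e s => h.abs_logZ_cons_sub_le e s) M M' 0

theorem α_nonneg (h : m.Interpolable lam A α g) : 0 ≤ α :=
  (h.gibbsMean_nonneg 0 _).trans (h.gibbsMean_le (N := 1) 0 (fun _ => 0, Classical.arbitrary _))

theorem increment_nonneg (h : m.Interpolable lam A α g) :
    0 ≤ |Real.log A| - Real.log (1 - α) := by
  have := Real.log_nonpos (by linarith [h.α_lt_one] : 0 ≤ 1 - α) (by linarith [h.α_nonneg])
  linarith [abs_nonneg (Real.log A)]

/-- With hyperedge density `c`, the mean of `log Z` is superadditive in the number of nodes up to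
an error of the order of the binomial fluctuations, which are governed by the smaller part. -/
theorem meanLogZ_superadditive (h : m.Interpolable lam A α g) {c : ℝ} (hc : 0 ≤ c) {n n' : ℕ}
    (hn : 0 < n) (hn' : 0 < n') :
    m.meanLogZ lam n ⌊c * n⌋₊ + m.meanLogZ lam n' ⌊c * n'⌋₊
      - 2 * (|Real.log A| - Real.log (1 - α)) * (c + 3) * √(min n n' : ℝ)
      ≤ m.meanLogZ lam (n + n') ⌊c * (n + n' : ℕ)⌋₊ := by
  set C := |Real.log A| - Real.log (1 - α) with hC
  have hC0 : 0 ≤ C := h.increment_nonneg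
  set M := ⌊c * (n + n' : ℕ)⌋₊ with hM
  set p : ℝ := n / (n + n') with hp
  set r : ℝ := min n n' with hr
  have hn0 : (1 : ℝ) ≤ n := by exact_mod_cast hn
  have hn0' : (1 : ℝ) ≤ n' := by exact_mod_cast hn'
  have hp0 : 0 ≤ p := by positivity
  have hp1 : p ≤ 1 := by
    rw [hp, div_le_one (by positivity)]
    linarith
  have hr1 : 1 ≤ √r := Real.one_le_sqrt.2 (le_min hn0 hn0')
  have hMf := abs_floor_mul_sub_le hc (n + n')
  rw [← hM] at hMf
  push_cast at hMf
  have hpn : c * (n + n') * p = c * n := by rw [hp]; field_simp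
  have hMp : |M * p - c * n| ≤ 1 := by
    rw [← hpn, ← sub_mul, abs_mul, abs_of_nonneg hp0]
    nlinarith [abs_nonneg ((M : ℝ) - c * (n + n'))]
  have hMp' : |M * (1 - p) - c * n'| ≤ 1 := by
    have h1 : M * (1 - p) - c * n' = (M - c * (n + n')) * (1 - p) := by linear_combination -hpn
    rw [h1, abs_mul, abs_of_nonneg (by linarith : 0 ≤ 1 - p)]
    nlinarith [abs_nonneg ((M : ℝ) - c * (n + n'))]
  have hfn := abs_floor_mul_sub_le hc n
  have hfn' := abs_floor_mul_sub_le hc n'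
  have hvar : M * p * (1 - p) ≤ c * r := by
    have h1 : (M : ℝ) ≤ c * (n + n') := by
      have := Nat.floor_le (by positivity : 0 ≤ c * (n + n' : ℕ))
      push_cast at this
      rw [hM]
      push_cast
      exact this
    have h2 : p * (1 - p) * (n + n') ≤ r := by
      have h3 : 1 - p = n' / (n + n') := by rw [hp]; field_simp; ring
      have h4 : p * (n + n') = n := by rw [hp]; field_simp
      have h5 : (1 - p) * (n + n') = n' := by rw [h3]; field_simp
      refine le_min ?_ ?_
      · nlinarith
      · nlinarith
    calc M * p * (1 - p) = M * (p * (1 - p)) := by ring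
      _ ≤ c * (n + n') * (p * (1 - p)) :=
        mul_le_mul_of_nonneg_right h1 (mul_nonneg hp0 (by linarith))
      _ = c * (p * (1 - p) * (n + n')) := by ring
      _ ≤ c * r := mul_le_mul_of_nonneg_left h2 hc
  have hdev := sum_binomial_abs_sub_le M hp0 hp1 (by linarith : 0 < √r)
  have hdev' : (M * p * (1 - p) / √r + √r) / 2 ≤ (c + 1) * √r := by
    have : M * p * (1 - p) / √r ≤ c * √r := by
      rw [div_le_iff₀ (by linarith), mul_assoc c, Real.mul_self_sqrt (by positivity)]
      exact hvar
    nlinarith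
  refine le_trans ?_ (h.sum_binomial_le_meanLogZ hn hn' M)
  set w : ℕ → ℝ := fun k => p ^ k * (1 - p) ^ (M - k) * (M.choose k : ℝ) with hw
  set a := m.meanLogZ lam n ⌊c * n⌋₊ + m.meanLogZ lam n' ⌊c * n'⌋₊ with ha
  have hsum : ∑ k ∈ Finset.range (M + 1), w k = 1 := sum_binomial_weight M p
  have step : ∑ k ∈ Finset.range (M + 1), w k * (a - 2 * C * (|k - M * p| + 2)) ≤
      ∑ k ∈ Finset.range (M + 1),
        w k * (m.meanLogZ lam n k + m.meanLogZ lam n' (M - k)) := by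
    refine Finset.sum_le_sum fun k hk => mul_le_mul_of_nonneg_left ?_ ?_
    · have hkM : k ≤ M := Nat.lt_succ_iff.1 (Finset.mem_range.1 hk)
      have e1 := h.abs_meanLogZ_sub_le hn ⌊c * n⌋₊ k
      have e2 := h.abs_meanLogZ_sub_le hn' ⌊c * n'⌋₊ (M - k)
      rw [← hC] at e1 e2
      rw [Nat.cast_sub hkM] at e2
      have d1 : |(⌊c * n⌋₊ : ℝ) - k| ≤ |k - M * p| + 2 := by
        rw [abs_le] at *
        constructor <;> cases abs_cases ((k : ℝ) - M * p) <;> linarith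
      have d2 : |(⌊c * n'⌋₊ : ℝ) - (M - k)| ≤ |k - M * p| + 2 := by
        rw [abs_le] at *
        constructor <;> cases abs_cases ((k : ℝ) - M * p) <;> linarith
      have := mul_le_mul_of_nonneg_left d1 hC0
      have := mul_le_mul_of_nonneg_left d2 hC0
      rw [ha]
      linarith [le_of_abs_le e1, le_of_abs_le e2]
    · have : 0 ≤ 1 - p := by linarith
      positivity
  refine le_trans ?_ step
  have hexp : ∑ k ∈ Finset.range (M + 1), w k * (a - 2 * C * (|k - M * p| + 2))
      = (a - 4 * C) * ∑ k ∈ Finset.range (M + 1), w k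
        - 2 * C * ∑ k ∈ Finset.range (M + 1), w k * |k - M * p| := by
    rw [Finset.mul_sum, Finset.mul_sum, ← Finset.sum_sub_distrib]
    exact Finset.sum_congr rfl fun k _ => by ring
  rw [hexp, hsum]
  have := mul_le_mul_of_nonneg_left (hdev.trans hdev') hC0
  have := mul_le_mul_of_nonneg_left hr1 hC0
  simp only [hw]
  linarith

theorem exists_tendsto_meanLogZ (h : m.Interpolable lam A α g) {c : ℝ} (hc : 0 ≤ c) :
    ∃ z, Tendsto (fun N : ℕ => m.meanLogZ lam N ⌊c * N⌋₊ / N) atTop (𝓝 z) := by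
  set C := |Real.log A| - Real.log (1 - α) with hC
  have hC0 : 0 ≤ C := h.increment_nonneg
  set D := 4 * C * (c + 3) with hD
  have hD0 : 0 ≤ D := by positivity
  -- The correction by `D * √n` absorbs the error, since `√n + √n' - √(n + n') ≥ √(min n n') / 2`.
  set u : ℕ → ℝ := fun n => D * √n - m.meanLogZ lam n ⌊c * n⌋₊ with hu
  have hu0 : u 0 = 0 := by
    simp [hu, meanLogZ_zero_right]
  have hsub : Subadditive u := by
    intro n n'
    rcases Nat.eq_zero_or_pos n with rfl | hn
    · simp [hu0]
    rcases Nat.eq_zero_or_pos n' with rfl | hn'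
    · simp [hu0]
    have h1 := h.meanLogZ_superadditive hc hn hn'
    have h2 := mul_le_mul_of_nonneg_left
      (half_sqrt_min_le (n : ℝ) n' (Nat.cast_nonneg n) (Nat.cast_nonneg n')) hD0
    simp only [hu]
    push_cast at h1 ⊢
    rw [← hC] at h1
    rw [hD] at h2 ⊢
    linarith
  have hbdd : BddBelow (Set.range fun n => u n / n) := by
    refine ⟨-(|Real.log (∑ s, lam ^ m.node s)| + C * c), ?_⟩
    rintro _ ⟨n, rfl⟩
    rcases Nat.eq_zero_or_pos n with rfl | hn
    · simp only [Nat.cast_zero, div_zero]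
      have : 0 ≤ |Real.log (∑ s, lam ^ m.node s)| := abs_nonneg _
      have : 0 ≤ C * c := by positivity
      linarith
    have hn0 : (0 : ℝ) < n := by exact_mod_cast hn
    have h1 := le_of_abs_le (h.abs_meanLogZ_sub_le hn ⌊c * n⌋₊ 0)
    rw [meanLogZ_zero_right, Nat.cast_zero, sub_zero, Nat.abs_cast,
      ← hC] at h1
    have h2 := mul_le_mul_of_nonneg_left (Nat.floor_le (by positivity : 0 ≤ c * n)) hC0
    have h3 := mul_le_mul_of_nonneg_left (le_abs_self (Real.log (∑ s, lam ^ m.node s))) hn0.le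
    have h4 : 0 ≤ D * √n := by positivity
    rw [le_div_iff₀ hn0]
    simp only [hu]
    linarith
  have hlim := hsub.tendsto_lim hbdd
  refine ⟨-hsub.lim, ?_⟩
  have hsqrt : Tendsto (fun n : ℕ => D * (1 / √(n : ℝ))) atTop (𝓝 (D * 0)) := by
    refine Tendsto.const_mul _ ?_
    simp only [one_div]
    exact tendsto_inv_atTop_zero.comp
      (Real.tendsto_sqrt_atTop.comp tendsto_natCast_atTop_atTop)
  have := hsqrt.sub hlim
  rw [mul_zero, zero_sub] at this
  refine this.congr fun n => ?_
  simp only [hu]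
  rw [one_div, ← Real.sqrt_div_self]
  ring

end Interpolable

/-! ### Simple instances have positive asymptotic density -/

open Classical in
/-- The probability that an instance with `M` independent uniform hyperedges is simple. -/
noncomputable def simpleProb (m : SpinModel) (N M : ℕ) : ℝ :=
  𝔼 G : m.Inst N M, if m.IsSimple G then 1 else 0

theorem isSimple_cons {m : SpinModel} {N M : ℕ} {G : m.Inst N M} (hG : m.IsSimple G)
    {e : m.Edge N} (he : Function.Injective e.1) (hne : ∀ j, Set.range (G j).1 ≠ Set.range e.1) :
    m.IsSimple (Fin.cons e G : m.Inst N (M + 1)) := by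
  refine ⟨Fin.cases he hG.1, ?_⟩
  have : (fun j => Set.range ((Fin.cons e G : m.Inst N (M + 1)) j).1)
      = Fin.cons (Set.range e.1) fun j => Set.range (G j).1 :=
    funext (Fin.cases rfl fun _ => rfl)
  rw [this, Fin.cons_injective_iff]
  exact ⟨fun ⟨j, hj⟩ => hne j hj, hG.2⟩

open Classical in
/-- At least `(N + 1 - K) ^ K` hyperedges have distinct nodes, and each of the `M` given ones
excludes at most `K ^ K` of them by its node set. -/
theorem card_admissible_ge {K N M : ℕ} (w : Fin M → Fin K → Fin N) :
    ((N + 1 - K) ^ K : ℕ) ≤ (Finset.univ.filter fun v : Fin K → Fin N =>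
      Function.Injective v ∧ ∀ j, Set.range (w j) ≠ Set.range v).card + M * K ^ K := by
  have h1 : (N + 1 - K) ^ K
      ≤ (Finset.univ.filter fun v : Fin K → Fin N => Function.Injective v).card := by
    have h2 := Fintype.card_embedding_eq (α := Fin K) (β := Fin N)
    rw [Fintype.card_fin, Fintype.card_fin,
      ← Fintype.card_congr (Equiv.subtypeInjectiveEquivEmbedding (Fin K) (Fin N)),
      Fintype.card_subtype] at h2
    rw [h2]
    exact Nat.pow_sub_le_descFactorial N K
  have h3 : (Finset.univ.biUnion fun j : Fin M =>
      Finset.univ.filter fun v : Fin K → Fin N => Set.range (w j) = Set.range v).card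
        ≤ M * K ^ K := by
    refine (Finset.card_biUnion_le_card_mul _ _ (K ^ K) fun j _ => ?_).trans_eq (by simp)
    have h4 : (Finset.univ.filter fun v : Fin K → Fin N => Set.range (w j) = Set.range v)
        ⊆ Fintype.piFinset fun _ => Finset.univ.image (w j) := by
      intro v hv
      rw [Fintype.mem_piFinset]
      intro k
      have h5 : v k ∈ Set.range (w j) := (Finset.mem_filter.1 hv).2 ▸ Set.mem_range_self k
      obtain ⟨i, hi⟩ := h5
      exact Finset.mem_image.2 ⟨i, Finset.mem_univ _, hi⟩
    refine (Finset.card_le_card h4).trans ?_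
    rw [Fintype.card_piFinset, Finset.prod_const, Finset.card_univ, Fintype.card_fin]
    exact Nat.pow_le_pow_left (Finset.card_image_le.trans_eq (by simp)) K
  refine h1.trans ((Finset.card_le_card ?_).trans ((Finset.card_union_le _ _).trans
    (Nat.add_le_add_left h3 _)))
  intro v hv
  have hv' := (Finset.mem_filter.1 hv).2
  by_cases h : ∀ j, Set.range (w j) ≠ Set.range v
  · exact Finset.mem_union_left _ (by simp [hv', h])
  · push Not at h
    exact Finset.mem_union_right _ (by simpa using h)

open Classical in
theorem expect_admissible_ge (m : SpinModel) (hK : 2 ≤ m.K) {c : ℝ} {N M : ℕ} (hN : m.K ≤ N)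
    (hM : (M : ℝ) ≤ c * N) (G : m.Inst N M) :
    1 - (m.K ^ 2 + c * m.K ^ m.K) / N ≤ 𝔼 e : m.Edge N,
      if Function.Injective e.1 ∧ ∀ j, Set.range (G j).1 ≠ Set.range e.1 then (1 : ℝ) else 0 := by
  have h1 := card_admissible_ge fun j => (G j).1
  have h0 : (𝔼 e : m.Edge N,
      if Function.Injective e.1 ∧ ∀ j, Set.range (G j).1 ≠ Set.range e.1 then (1 : ℝ) else 0)
      = 𝔼 v : Fin m.K → Fin N,
        if Function.Injective v ∧ ∀ j, Set.range (G j).1 ≠ Set.range v then (1 : ℝ) else 0 := by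
    rw [← Finset.univ_product_univ, Finset.expect_product]
    exact Finset.expect_congr rfl fun v _ => Fintype.expect_const
      (if Function.Injective v ∧ ∀ j, Set.range (G j).1 ≠ Set.range v then (1 : ℝ) else 0)
  rw [h0, Fintype.expect_eq_sum_div_card, Finset.sum_boole, Fintype.card_fun, Fintype.card_fin,
    Fintype.card_fin, Nat.cast_pow]
  have hN0 : (0 : ℝ) < N := by exact_mod_cast (by omega : 0 < N)
  have hN1 : (1 : ℝ) ≤ N := by exact_mod_cast (by omega : 1 ≤ N)
  have h2 := (Nat.cast_le (α := ℝ)).2 h1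
  rw [Nat.cast_pow, Nat.cast_add, Nat.cast_mul, Nat.cast_pow] at h2
  have h3 : (N : ℝ) * (1 - m.K / N) ≤ ((N + 1 - m.K : ℕ) : ℝ) := by
    rw [Nat.cast_sub (by omega)]
    push_cast
    field_simp
    linarith
  have hKN : (m.K : ℝ) / N ≤ 1 := by
    rw [div_le_one hN0]
    exact_mod_cast hN
  have h4 : (N : ℝ) ^ m.K * (1 - m.K * (m.K / N)) ≤ ((N + 1 - m.K : ℕ) : ℝ) ^ m.K := by
    have h5 := one_add_mul_le_pow (a := -(m.K / N : ℝ)) (by linarith) m.K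
    calc (N : ℝ) ^ m.K * (1 - m.K * (m.K / N)) ≤ (N : ℝ) ^ m.K * (1 - m.K / N) ^ m.K := by
          refine mul_le_mul_of_nonneg_left ?_ (by positivity)
          simpa [sub_eq_add_neg] using h5
      _ = ((N : ℝ) * (1 - m.K / N)) ^ m.K := (mul_pow _ _ _).symm
      _ ≤ _ := pow_le_pow_left₀ (mul_nonneg hN0.le (by linarith)) h3 _
  have h6 : (M : ℝ) * m.K ^ m.K ≤ (N : ℝ) ^ m.K * (c * m.K ^ m.K / N) := by
    have h7 : (N : ℝ) ^ 2 ≤ (N : ℝ) ^ m.K := pow_le_pow_right₀ hN1 hK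
    have hc : 0 ≤ c := by
      by_contra hc
      have : c * N < 0 := mul_neg_of_neg_of_pos (not_le.1 hc) hN0
      linarith [(Nat.cast_nonneg M : (0 : ℝ) ≤ M)]
    calc (M : ℝ) * m.K ^ m.K ≤ c * N * m.K ^ m.K :=
          mul_le_mul_of_nonneg_right hM (by positivity)
      _ = (N : ℝ) ^ 2 * (c * m.K ^ m.K / N) := by field_simp
      _ ≤ _ := mul_le_mul_of_nonneg_right h7 (by positivity)
  rw [le_div_iff₀ (by positivity)]
  have h8 : (1 - ((m.K : ℝ) ^ 2 + c * m.K ^ m.K) / N) * N ^ m.K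
      = (N : ℝ) ^ m.K * (1 - m.K * (m.K / N)) - (N : ℝ) ^ m.K * (c * m.K ^ m.K / N) := by
    ring
  rw [h8]
  linarith

theorem simpleProb_ge (m : SpinModel) (hK : 2 ≤ m.K) {c : ℝ} {N : ℕ} (hN : m.K ≤ N)
    (hA : (m.K ^ 2 + c * m.K ^ m.K) / N ≤ 1) (M : ℕ) (hM : (M : ℝ) ≤ c * N) :
    (1 - (m.K ^ 2 + c * m.K ^ m.K) / N) ^ M ≤ m.simpleProb N M := by
  classical
  induction M with
  | zero =>
    have : ∀ G : m.Inst N 0, m.IsSimple G := fun G => ⟨fun j => j.elim0, fun j => j.elim0⟩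
    simp [simpleProb, this]
  | succ M ih =>
    have hM' : (M : ℝ) ≤ c * N := by push_cast at hM; linarith
    have h1 : m.simpleProb N (M + 1) = 𝔼 G : m.Inst N M, 𝔼 e : m.Edge N,
        if m.IsSimple (Fin.cons e G : m.Inst N (M + 1)) then (1 : ℝ) else 0 := by
      rw [simpleProb, ← Fintype.expect_equiv (Fin.consEquiv fun _ => m.Edge N)
        (fun p => if m.IsSimple (Fin.cons p.1 p.2 : m.Inst N (M + 1)) then (1 : ℝ) else 0)
        _ fun _ => rfl, ← Finset.univ_product_univ, Finset.expect_product, Finset.expect_comm]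
    rw [pow_succ, h1]
    refine (mul_le_mul_of_nonneg_right (ih hM') (by linarith)).trans ?_
    rw [simpleProb, Finset.expect_mul]
    refine Finset.expect_le_expect fun G _ => ?_
    by_cases hG : m.IsSimple G
    · rw [if_pos hG, one_mul]
      refine (expect_admissible_ge m hK hN hM' G).trans (Finset.expect_le_expect fun e _ => ?_)
      by_cases he : Function.Injective e.1 ∧ ∀ j, Set.range (G j).1 ≠ Set.range e.1
      · rw [if_pos he, if_pos (isSimple_cons hG he.1 he.2)]
      · rw [if_neg he]
        split_ifs <;> norm_num
    · rw [if_neg hG, zero_mul]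
      exact Finset.expect_nonneg fun e _ => by split_ifs <;> norm_num

/-- At linear density the probability of being simple does not vanish. The conditional law given
simplicity therefore inherits every property that holds with high probability. -/
theorem exists_le_simpleProb (m : SpinModel) (hK : 2 ≤ m.K) {c : ℝ} (hc : 0 ≤ c) :
    ∃ δ : ℝ, 0 < δ ∧ ∀ᶠ N : ℕ in atTop, δ ≤ m.simpleProb N ⌊c * N⌋₊ := by
  set A : ℝ := m.K ^ 2 + c * m.K ^ m.K with hA
  have hA0 : 0 ≤ A := by positivity
  refine ⟨Real.exp (-(2 * A * c)), Real.exp_pos _, ?_⟩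
  filter_upwards [eventually_ge_atTop m.K, eventually_ge_atTop ⌈2 * A⌉₊] with N hN hNA
  have hN0 : (0 : ℝ) < N := by exact_mod_cast (by omega : 0 < N)
  have h2A : 2 * A ≤ N := (Nat.le_ceil _).trans (by exact_mod_cast hNA)
  have hx : A / N ≤ 1 / 2 := by
    rw [div_le_iff₀ hN0]
    linarith
  have hx0 : 0 ≤ A / N := by positivity
  have hfl : (⌊c * N⌋₊ : ℝ) ≤ c * N := Nat.floor_le (by positivity)
  refine le_trans ?_ (simpleProb_ge m hK (c := c) hN (by linarith) _ hfl)
  -- `exp (-2x) ≤ 1 - x` on `[0, 1/2]`, since `(1 + 2x) (1 - x) ≥ 1` there.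
  have h1 : Real.exp (-(2 * (A / N))) ≤ 1 - A / N := by
    rw [Real.exp_neg, inv_le_iff_one_le_mul₀ (Real.exp_pos _)]
    nlinarith [Real.add_one_le_exp (2 * (A / N))]
  calc Real.exp (-(2 * A * c)) ≤ Real.exp (-(2 * (A / N))) ^ ⌊c * N⌋₊ := by
        rw [← Real.exp_nat_mul, Real.exp_le_exp]
        have h2 : (⌊c * N⌋₊ : ℝ) * (2 * (A / N)) ≤ c * N * (2 * (A / N)) :=
          mul_le_mul_of_nonneg_right hfl (by positivity)
        have h3 : c * N * (2 * (A / N)) = 2 * A * c := by field_simp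
        linarith
    _ ≤ _ := pow_le_pow_left₀ (Real.exp_pos _).le h1 _

/-! ### Concentration -/

theorem uniformLaw_apply {Ω : Type} [Finite Ω] (S T : Set Ω) :
    uniformLaw S T = ((S.ncard : ℝ≥0∞))⁻¹ * ((S ∩ T).ncard : ℝ≥0∞) := by
  let _ : MeasurableSpace Ω := ⊤
  have h1 : ∀ U : Set Ω, Measure.count U = (U.ncard : ℝ≥0∞) := by
    intro U
    rw [Measure.count_apply MeasurableSpace.measurableSet_top, ← (Set.toFinite U).cast_ncard_eq]
    rfl
  rw [uniformLaw, ProbabilityTheory.uniformOn,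
    ProbabilityTheory.cond_apply MeasurableSpace.measurableSet_top, h1, h1]

theorem uniformLaw_le_of_ncard_le {Ω : Type} [Finite Ω] [Nonempty Ω] {S T : Set Ω} {δ r : ℝ}
    (hδ : 0 < δ) (hS : δ * Nat.card Ω ≤ S.ncard) (hT : (T.ncard : ℝ) ≤ r * Nat.card Ω) :
    uniformLaw S T ≤ ENNReal.ofReal (r / δ) := by
  have hΩ : (0 : ℝ) < Nat.card Ω := by exact_mod_cast Nat.card_pos
  have hS0 : (0 : ℝ) < S.ncard := lt_of_lt_of_le (by positivity) hS
  have hST : ((S ∩ T).ncard : ℝ) ≤ r * Nat.card Ω :=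
    le_trans (by exact_mod_cast Set.ncard_le_ncard Set.inter_subset_right) hT
  have hr : 0 ≤ r := by
    by_contra hr
    have := mul_neg_of_neg_of_pos (not_le.1 hr) hΩ
    linarith [(Nat.cast_nonneg _ : (0 : ℝ) ≤ T.ncard)]
  rw [uniformLaw_apply, ← ENNReal.ofReal_natCast, ← ENNReal.ofReal_natCast,
    ← ENNReal.ofReal_inv_of_pos hS0, ← ENNReal.ofReal_mul (by positivity)]
  refine ENNReal.ofReal_le_ofReal ?_
  rw [inv_mul_le_iff₀ hS0]
  calc ((S ∩ T).ncard : ℝ) ≤ r * Nat.card Ω := hST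
    _ = (δ * Nat.card Ω) * (r / δ) := by field_simp
    _ ≤ _ := mul_le_mul_of_nonneg_right hS (by positivity)

namespace Interpolable

variable {m : SpinModel} {lam A α : ℝ} {g : m.Mark → (Fin m.K → Fin m.q) → ℝ}

/-- Chebyshev's inequality for `log Z`, in terms of counts. -/
theorem ncard_deviation_le (h : m.Interpolable lam A α g) {N : ℕ} (hN : 0 < N) (M : ℕ) {t : ℝ}
    (ht : 0 < t) :
    (({G : m.Inst N M | t < |Real.log (m.partitionFn lam G) - m.meanLogZ lam N M|}.ncard : ℕ) : ℝ)
      ≤ M * (|Real.log A| - Real.log (1 - α)) ^ 2 / t ^ 2 * Nat.card (m.Inst N M) := by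
  classical
  have : Nonempty (m.Edge N) := nonempty_edge m hN
  set μ := m.meanLogZ lam N M with hμ
  have h1 := insertAvg.pow_sq_sub_sq_le (id : m.Edge N → m.Edge N)
    (fun e s => h.abs_logZ_cons_sub_le e s) M 0
  have h2 : (insertAvg (id : m.Edge N → m.Edge N) ^ M) (m.logZ lam) 0 = μ := rfl
  have h3 : 𝔼 G : m.Inst N M, (Real.log (m.partitionFn lam G) - μ) ^ 2
      = (insertAvg (id : m.Edge N → m.Edge N) ^ M) (fun s => m.logZ lam s ^ 2) 0 - μ ^ 2 := by
    have h4 : ∀ G : m.Inst N M, (Real.log (m.partitionFn lam G) - μ) ^ 2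
        = m.logZ lam (Finset.univ.val.map G + 0) ^ 2
          - 2 * μ * m.logZ lam (Finset.univ.val.map G + 0) + μ ^ 2 := by
      intro G
      rw [log_partitionFn m h.lam_pos, add_zero]
      ring
    simp only [h4]
    rw [Finset.expect_add_distrib, Finset.expect_sub_distrib, ← Finset.mul_expect,
      ← insertAvg.pow_eq_expect_fin, ← insertAvg.pow_eq_expect_fin M (fun s => m.logZ lam s ^ 2),
      h2, Fintype.expect_const]
    ring
  rw [h2, ← h3, Fintype.expect_eq_sum_div_card] at h1
  have hcard : (0 : ℝ) < Fintype.card (m.Inst N M) := by exact_mod_cast Fintype.card_pos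
  rw [div_le_iff₀ hcard] at h1
  rw [Set.ncard_eq_toFinset_card', Set.toFinset_ofPred, Nat.card_eq_fintype_card,
    div_mul_eq_mul_div, le_div_iff₀ (by positivity)]
  refine le_trans ?_ h1
  rw [← nsmul_eq_mul]
  refine (Finset.card_nsmul_le_sum _ _ _ fun G hG => ?_).trans
    (Finset.sum_le_sum_of_subset_of_nonneg (Finset.filter_subset _ _) fun _ _ _ => sq_nonneg _)
  rw [← sq_abs (Real.log _ - μ)]
  exact pow_le_pow_left₀ ht.le (Finset.mem_filter.1 hG).2.le 2

/-- Under the uniform law on any family of sets of instances with positive lower density,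
`N⁻¹ log Z` converges in probability to the limit of its mean. -/
theorem tendsto_uniformLaw_deviation (h : m.Interpolable lam A α g) {c : ℝ} (hc : 0 ≤ c) {z : ℝ}
    (hz : Tendsto (fun N : ℕ => m.meanLogZ lam N ⌊c * N⌋₊ / N) atTop (𝓝 z)) {ε : ℝ}
    (hε : 0 < ε) {δ : ℝ} (hδ : 0 < δ) (S : ∀ N : ℕ, Set (m.Inst N ⌊c * N⌋₊))
    (hS : ∀ᶠ N : ℕ in atTop, δ * Nat.card (m.Inst N ⌊c * N⌋₊) ≤ (S N).ncard) :
    Tendsto (fun N : ℕ => uniformLaw (S N)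
      {G | ε < |(N : ℝ)⁻¹ * Real.log (m.partitionFn lam G) - z|}) atTop (𝓝 0) := by
  set C := |Real.log A| - Real.log (1 - α) with hC
  have hlim : Tendsto (fun N : ℕ => ENNReal.ofReal (c * C ^ 2 / (ε / 2) ^ 2 / δ * (N : ℝ)⁻¹))
      atTop (𝓝 0) := by
    rw [← ENNReal.ofReal_zero]
    refine ENNReal.tendsto_ofReal ?_
    simpa using (tendsto_inv_atTop_nhds_zero_nat (𝕜 := ℝ)).const_mul
      (c * C ^ 2 / (ε / 2) ^ 2 / δ)
  refine tendsto_of_tendsto_of_tendsto_of_le_of_le' tendsto_const_nhds hlim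
    (Eventually.of_forall fun _ => zero_le) ?_
  filter_upwards [hS, eventually_gt_atTop 0, Metric.tendsto_nhds.1 hz (ε / 2) (half_pos hε)] with
    N hSN hN hzN
  have : Nonempty (m.Edge N) := nonempty_edge m hN
  have hN0 : (0 : ℝ) < N := by exact_mod_cast hN
  have hfl : (⌊c * N⌋₊ : ℝ) ≤ c * N := Nat.floor_le (by positivity)
  have hdev := h.ncard_deviation_le hN ⌊c * N⌋₊ (t := ε / 2 * N) (by positivity)
  have hsub : {G : m.Inst N ⌊c * N⌋₊ | ε < |(N : ℝ)⁻¹ * Real.log (m.partitionFn lam G) - z|} ⊆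
      {G | ε / 2 * N < |Real.log (m.partitionFn lam G) - m.meanLogZ lam N ⌊c * N⌋₊|} := by
    intro G hG
    rw [Set.mem_ofPred_eq] at hG ⊢
    rw [Real.dist_eq] at hzN
    have h1 := abs_sub_le ((N : ℝ)⁻¹ * Real.log (m.partitionFn lam G))
      (m.meanLogZ lam N ⌊c * N⌋₊ / N) z
    have h2 : (N : ℝ)⁻¹ * Real.log (m.partitionFn lam G) - m.meanLogZ lam N ⌊c * N⌋₊ / N
        = (Real.log (m.partitionFn lam G) - m.meanLogZ lam N ⌊c * N⌋₊) / N := by ring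
    have h3 : ε / 2 < |Real.log (m.partitionFn lam G) - m.meanLogZ lam N ⌊c * N⌋₊| / N := by
      rw [h2, abs_div, abs_of_pos hN0] at h1
      linarith
    exact (lt_div_iff₀ hN0).1 h3
  have hT := le_trans (Nat.cast_le.2 (Set.ncard_le_ncard hsub)) hdev
  refine (uniformLaw_le_of_ncard_le hδ hSN hT).trans (ENNReal.ofReal_le_ofReal ?_)
  rw [← hC]
  calc (⌊c * N⌋₊ : ℝ) * C ^ 2 / (ε / 2 * N) ^ 2 / δ ≤ (c * N) * C ^ 2 / (ε / 2 * N) ^ 2 / δ := by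
        gcongr
    _ = _ := by field_simp

/-- Concentration upgrades convergence of the mean to convergence in probability, for both laws. -/
theorem tendsto_laws (h : m.Interpolable lam A α g) {c : ℝ} (hc : 0 ≤ c) {z : ℝ}
    (hz : Tendsto (fun N : ℕ => m.meanLogZ lam N ⌊c * N⌋₊ / N) atTop (𝓝 z)) {ε : ℝ}
    (hε : 0 < ε) :
    Tendsto (fun N : ℕ => m.erLaw N ⌊c * N⌋₊
        {G | ε < |(N : ℝ)⁻¹ * Real.log (m.partitionFn lam G) - z|}) atTop (𝓝 0) ∧
    Tendsto (fun N : ℕ => m.simpleErLaw N ⌊c * N⌋₊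
        {G | ε < |(N : ℝ)⁻¹ * Real.log (m.partitionFn lam G) - z|}) atTop (𝓝 0) := by
  classical
  refine ⟨h.tendsto_uniformLaw_deviation hc hz hε one_pos _
    (Eventually.of_forall fun N => by rw [Set.ncard_univ, one_mul]), ?_⟩
  obtain ⟨δ, hδ, hsimple⟩ := exists_le_simpleProb m h.two_le_K hc
  refine h.tendsto_uniformLaw_deviation hc hz hε hδ _ ?_
  filter_upwards [hsimple, eventually_gt_atTop 0] with N hN hN0
  have : Nonempty (m.Edge N) := nonempty_edge m hN0
  have hcard : (0 : ℝ) < Fintype.card (m.Inst N ⌊c * N⌋₊) := by exact_mod_cast Fintype.card_pos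
  rw [simpleProb, Fintype.expect_eq_sum_div_card, Finset.sum_boole, le_div_iff₀ hcard] at hN
  rw [Set.ncard_eq_toFinset_card', Set.toFinset_ofPred, Nat.card_eq_fintype_card]
  exact hN

/-! ### The limit as a function of the density -/

/-- The limit exists, is Lipschitz, and is monotone in the direction in which a hyperedge changes
the weights. -/
theorem exists_limit (h : m.Interpolable lam A α g) :
    ∃ z : ℝ → ℝ, m.LogPartitionLimit lam z ∧ (∃ L : ℝ≥0, LipschitzOnWith L z (Set.Ioi 0)) ∧
      ((∀ a y, 1 ≤ powBot lam (m.edge a y)) → MonotoneOn z (Set.Ioi 0)) ∧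
      ((∀ a y, powBot lam (m.edge a y) ≤ 1) → AntitoneOn z (Set.Ioi 0)) := by
  have hex : ∀ c : ℝ, ∃ z, 0 ≤ c →
      Tendsto (fun N : ℕ => m.meanLogZ lam N ⌊c * N⌋₊ / N) atTop (𝓝 z) := by
    intro c
    by_cases hc : 0 ≤ c
    · obtain ⟨z, hz⟩ := h.exists_tendsto_meanLogZ hc
      exact ⟨z, fun _ => hz⟩
    · exact ⟨0, fun hc' => absurd hc' hc⟩
  choose z hz using hex
  have hfloor : ∀ {c c' : ℝ}, c ≤ c' → ∀ N : ℕ, ⌊c * N⌋₊ ≤ ⌊c' * N⌋₊ := fun hcc N =>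
    Nat.floor_le_floor (mul_le_mul_of_nonneg_right hcc (Nat.cast_nonneg N))
  refine ⟨z, fun c hc ε hε => h.tendsto_laws hc.le (hz c hc.le) hε,
    ⟨⟨_, h.increment_nonneg⟩, LipschitzOnWith.of_dist_le_mul fun c hc c' hc' => ?_⟩, ?_, ?_⟩
  · rw [Set.mem_Ioi] at hc hc'
    rw [Real.dist_eq, Real.dist_eq]
    change _ ≤ (|Real.log A| - Real.log (1 - α)) * |c - c'|
    set C := |Real.log A| - Real.log (1 - α) with hC
    have hC0 : 0 ≤ C := h.increment_nonneg
    have h1 := ((hz c hc.le).sub (hz c' hc'.le)).abs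
    have h2 : Tendsto (fun N : ℕ => C * |c - c'| + 2 * C * (N : ℝ)⁻¹) atTop
        (𝓝 (C * |c - c'|)) := by
      simpa using ((tendsto_inv_atTop_nhds_zero_nat (𝕜 := ℝ)).const_mul (2 * C)).const_add
        (C * |c - c'|)
    refine le_of_tendsto_of_tendsto h1 h2 ?_
    filter_upwards [eventually_gt_atTop 0] with N hN
    have hN0 : (0 : ℝ) < N := by exact_mod_cast hN
    have h3 := h.abs_meanLogZ_sub_le hN ⌊c * N⌋₊ ⌊c' * N⌋₊
    rw [← hC] at h3
    have h4 : |(⌊c * N⌋₊ : ℝ) - ⌊c' * N⌋₊| ≤ |c - c'| * N + 2 := by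
      have e1 := abs_floor_mul_sub_le hc.le N
      have e2 := abs_floor_mul_sub_le hc'.le N
      have e3 : |c * N - c' * N| = |c - c'| * N := by
        rw [← sub_mul, abs_mul, abs_of_pos hN0]
      rw [← e3]
      rw [abs_le] at *
      constructor <;> cases abs_cases (c * N - c' * N) <;> linarith
    rw [← sub_div, abs_div, abs_of_pos hN0, div_le_iff₀ hN0]
    calc _ ≤ C * (|c - c'| * N + 2) := h3.trans (mul_le_mul_of_nonneg_left h4 hC0)
      _ = _ := by field_simp
  · intro hedge c hc c' hc' hcc
    refine le_of_tendsto_of_tendsto (hz c (le_of_lt hc)) (hz c' (le_of_lt hc')) ?_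
    filter_upwards [eventually_gt_atTop 0] with N hN
    have : Nonempty (m.Edge N) := nonempty_edge m hN
    refine div_le_div_of_nonneg_right (insertAvg.pow_mono_of_le_cons _ (fun e s => ?_) 0
      (hfloor hcc N)) (Nat.cast_nonneg N)
    refine Real.log_le_log (h.sum_weight_pos s) (Finset.sum_le_sum fun x _ => ?_)
    rw [weight_cons]
    exact le_mul_of_one_le_left (weight_nonneg m h.lam_pos s x) (hedge _ _)
  · intro hedge c hc c' hc' hcc
    refine le_of_tendsto_of_tendsto (hz c' (le_of_lt hc')) (hz c (le_of_lt hc)) ?_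
    filter_upwards [eventually_gt_atTop 0] with N hN
    have : Nonempty (m.Edge N) := nonempty_edge m hN
    refine div_le_div_of_nonneg_right (insertAvg.pow_anti_of_cons_le _ (fun e s => ?_) 0
      (hfloor hcc N)) (Nat.cast_nonneg N)
    refine Real.log_le_log (h.sum_weight_pos (e ::ₘ s)) (Finset.sum_le_sum fun x _ => ?_)
    rw [weight_cons]
    exact mul_le_of_le_one_left (weight_nonneg m h.lam_pos s x) (hedge _ _)

end Interpolable

/-! ### The models -/

/-- The soft models: a hyperedge multiplies the weight by `A * (1 - α * p)` with `0 ≤ p ≤ 1` and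
`α < 1`. The bound on Gibbs means is then pointwise. -/
theorem interpolable_of_soft (K q : ℕ) (Mark : Type) [Fintype Mark] [Nonempty Mark]
    (node : Fin q → ℝ) (edge : Mark → (Fin K → Fin q) → WithBot ℝ) {lam A α : ℝ}
    (p : Mark → (Fin K → Fin q) → ℝ) (hK : 2 ≤ K) (hq : 0 < q) (hlam : 0 < lam) (hA : 0 < A)
    (hα0 : 0 ≤ α) (hα1 : α < 1) (hp0 : ∀ a y, 0 ≤ p a y) (hp1 : ∀ a y, p a y ≤ 1)
    (hedge : ∀ a y, powBot lam (edge a y) = A * (1 - α * p a y))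
    (hrep : ∀ k : ℕ, ∃ (S : Type) (_ : Fintype S) (φ : S → (Fin k → Fin q) → ℝ),
      (∀ s v, 0 ≤ φ s v) ∧ ∀ y : Fin k → Fin K → Fin q,
        ∑ a, ∏ l, p a (y l) = ∑ s, ∏ j, φ s fun l => y l j) :
    Interpolable { K := K, q := q, Mark := Mark, node := node, edge := edge } lam A α
      (fun a y => α * p a y) where
  lam_pos := hlam
  two_le_K := hK
  q_pos := hq
  A_pos := hA
  α_lt_one := hα1
  g_nonneg a y := mul_nonneg hα0 (hp0 a y)
  powBot_edge := hedge
  gibbs_le N s e := by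
    rw [Finset.mul_sum]
    refine Finset.sum_le_sum fun x _ => ?_
    rw [mul_comm]
    exact mul_le_mul_of_nonneg_right (mul_le_of_le_one_right hα0 (hp1 _ _))
      (weight_nonneg _ hlam s x)
  replica k := by
    obtain ⟨S, hS, φ, hφ0, hφ⟩ := hrep k
    refine ⟨S, hS, α ^ k, φ, pow_nonneg hα0 k, hφ0, fun y => ?_⟩
    simp only [Finset.prod_mul_distrib, Finset.prod_const, Finset.card_univ, Fintype.card_fin,
      ← Finset.mul_sum]
    rw [hφ]

theorem indicator_nonneg (p : Prop) [Decidable p] : (0 : ℝ) ≤ if p then 1 else 0 := by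
  split_ifs <;> norm_num

theorem indicator_le_one (p : Prop) [Decidable p] : (if p then (1 : ℝ) else 0) ≤ 1 := by
  split_ifs <;> norm_num

theorem prod_indicator {ι : Type*} [Fintype ι] (p : ι → Prop) [DecidablePred p]
    [Decidable (∀ i, p i)] :
    ∏ i, (if p i then (1 : ℝ) else 0) = if ∀ i, p i then 1 else 0 := by
  simp [Finset.prod_ite_zero]

theorem sum_indicator_mul_indicator {κ : Type*} [Fintype κ] [DecidableEq κ] (u v : κ) :
    ∑ w, (if u = w then (1 : ℝ) else 0) * (if v = w then (1 : ℝ) else 0) =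
      if u = v then 1 else 0 := by
  simp

/-- Pair models that reward different spins. The replicated indicator of equal spins is a sum of
squares over the vectors of replicated spins. -/
theorem interpolable_of_pair (q : ℕ) (hq : 0 < q) (node : Fin q → ℝ)
    (edge : Unit → (Fin 2 → Fin q) → WithBot ℝ) {lam A α : ℝ} (hlam : 0 < lam) (hA : 0 < A)
    (hα : 0 ≤ α ∧ α < 1)
    (hedge : ∀ a y, powBot lam (edge a y) = A * (1 - α * if y 0 = y 1 then 1 else 0)) :
    Interpolable { K := 2, q := q, Mark := Unit, node := node, edge := edge } lam A α
      (fun _ y => α * if y 0 = y 1 then 1 else 0) := by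
  refine interpolable_of_soft 2 q Unit node edge (fun _ y => if y 0 = y 1 then 1 else 0) le_rfl hq
    hlam hA hα.1 hα.2 (fun _ _ => indicator_nonneg _) (fun _ _ => indicator_le_one _) hedge
    fun k => ⟨Fin k → Fin q, inferInstance, fun v u => if u = v then 1 else 0,
      fun _ _ => indicator_nonneg _, fun y => ?_⟩
  simp only [Finset.univ_unique, Finset.sum_singleton, Fin.prod_univ_two]
  rw [sum_indicator_mul_indicator, prod_indicator]
  simp only [funext_iff]

theorem one_sub_inv_mem {r : ℝ} (hr : 1 ≤ r) : 0 ≤ 1 - r⁻¹ ∧ 1 - r⁻¹ < 1 :=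
  ⟨sub_nonneg.2 (inv_le_one_of_one_le₀ hr), sub_lt_self _ (inv_pos.2 (by linarith))⟩

theorem powBot_zero (lam : ℝ) : powBot lam 0 = 1 := Real.rpow_zero lam

theorem powBot_one (lam : ℝ) : powBot lam 1 = lam := Real.rpow_one lam

theorem powBot_unit_eq {lam : ℝ} (hlam : 1 ≤ lam) (p : Prop) [Decidable p] :
    powBot lam (if p then 0 else 1) = lam * (1 - (1 - lam⁻¹) * if p then 1 else 0) := by
  have : lam ≠ 0 := by positivity
  split_ifs
  · rw [powBot_zero]
    field_simp
    ring
  · rw [powBot_one]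
    ring

theorem one_le_powBot_unit {lam : ℝ} (hlam : 1 ≤ lam) (p : Prop) [Decidable p] :
    1 ≤ powBot lam (if p then 0 else 1) := by
  split_ifs
  · rw [powBot_zero]
  · rwa [powBot_one]

theorem interpolable_coloring {lam : ℝ} (hlam : 1 ≤ lam) {q : ℕ} (hq : 1 ≤ q) :
    (coloring q).Interpolable lam lam (1 - lam⁻¹)
      (fun (_ : Unit) (y : Fin 2 → Fin q) => (1 - lam⁻¹) * if y 0 = y 1 then 1 else 0) :=
  interpolable_of_pair q hq _ _ (by linarith) (by linarith) (one_sub_inv_mem hlam)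
    fun _ _ => powBot_unit_eq hlam _

theorem interpolable_ising {lam : ℝ} (hlam : 1 ≤ lam) {β : ℝ} (hβ : 0 < β) (B : ℝ) :
    (ising β B).Interpolable lam (lam ^ β) (1 - (lam ^ (2 * β))⁻¹)
      (fun (_ : Unit) (y : Fin 2 → Fin 2) =>
        (1 - (lam ^ (2 * β))⁻¹) * if y 0 = y 1 then 1 else 0) := by
  have h1 : 1 ≤ lam ^ (2 * β) := Real.one_le_rpow hlam (by positivity)
  have hlam0 : 0 < lam := by linarith
  refine interpolable_of_pair 2 two_pos _ _ hlam0 (Real.rpow_pos_of_pos hlam0 β)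
    (one_sub_inv_mem h1) fun a y => ?_
  split_ifs
  · change lam ^ (-β) = _
    rw [← Real.rpow_neg hlam0.le, mul_one, sub_sub_cancel, ← Real.rpow_add hlam0]
    ring_nf
  · change lam ^ β = _
    ring

/-- In the independent set model, at least a fraction `1 / (1 + lam)` of the weight is carried by
configurations in which a given node is empty: emptying an occupied node keeps a configuration
admissible and costs a factor `lam`. -/
theorem independentSet_sum_occupied_le {lam : ℝ} (hlam : 0 < lam) {N : ℕ}
    (s : Multiset (independentSet.Edge N)) (u : Fin N) :
    ∑ x : Fin N → Fin 2, independentSet.weight lam s x * (if x u = 1 then 1 else 0)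
      ≤ lam / (1 + lam) * ∑ x, independentSet.weight lam s x := by
  set W : (Fin N → Fin 2) → ℝ := independentSet.weight lam s with hW
  have hflip : ∀ x : Fin N → Fin 2, x u = 1 → W x ≤ lam * W (Function.update x u 0) := by
    intro x hx
    simp only [hW, weight]
    rw [← mul_assoc]
    refine mul_le_mul ?_ ?_ ?_ ?_
    · rw [← Finset.mul_prod_erase _ _ (Finset.mem_univ u),
        ← Finset.mul_prod_erase _ (fun i => lam ^ independentSet.node (Function.update x u 0 i))
          (Finset.mem_univ u), ← mul_assoc]
      refine le_of_eq (congrArg₂ _ ?_ (Finset.prod_congr rfl fun i hi => ?_))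
      · simp [independentSet, hx]
      · rw [Function.update_of_ne (Finset.ne_of_mem_erase hi)]
    · refine Multiset.prod_map_le_prod_map₀ _ _ (fun e _ => powBot_nonneg hlam.le _)
        fun e _ => ?_
      simp only [independentSet, Function.comp_apply, Function.update_apply]
      split_ifs <;> simp_all [powBot]
    · refine Multiset.prod_nonneg fun a ha => ?_
      obtain ⟨e, -, rfl⟩ := Multiset.mem_map.1 ha
      exact powBot_nonneg hlam.le _
    · exact mul_nonneg hlam.le (Finset.prod_nonneg fun i _ => (Real.rpow_pos_of_pos hlam _).le)
  have hsum : ∑ x, W x * (if x u = 1 then 1 else 0)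
      ≤ lam * ∑ x, W x * (if x u = 1 then 0 else 1) := by
    simp only [mul_ite, mul_one, mul_zero]
    rw [Finset.mul_sum, ← Finset.sum_filter]
    have hinj : Set.InjOn (fun x : Fin N → Fin 2 => Function.update x u 0)
        (Finset.univ.filter fun x : Fin N → Fin 2 => x u = 1) := by
      intro x hx y hy hxy
      ext i
      have hx' : x u = 1 := by simpa using hx
      have hy' : y u = 1 := by simpa using hy
      have := congrFun hxy i
      by_cases hi : i = u
      · rw [hi, hx', hy']
      · simpa [hi] using congrArg Fin.val this
    calc ∑ x with x u = 1, W x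
        ≤ ∑ x with x u = 1, lam * W (Function.update x u 0) :=
          Finset.sum_le_sum fun x hx => hflip x (Finset.mem_filter.1 hx).2
      _ = ∑ x with x u = 1, (fun x' : Fin N → Fin 2 => lam * if x' u = 1 then 0 else W x')
            (Function.update x u 0) := by simp
      _ = ∑ x ∈ (Finset.univ.filter fun x : Fin N → Fin 2 => x u = 1).image
            (fun x => Function.update x u 0), lam * (if x u = 1 then 0 else W x) :=
          (Finset.sum_image
            (f := fun x : Fin N → Fin 2 => lam * if x u = 1 then 0 else W x) hinj).symm
      _ ≤ _ := Finset.sum_le_sum_of_subset_of_nonneg (Finset.subset_univ _) fun x _ _ =>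
          mul_nonneg hlam.le (by
            split_ifs
            · exact le_rfl
            · exact weight_nonneg _ hlam s x)
  have hsplit : ∑ x, W x = ∑ x, W x * (if x u = 1 then 1 else 0)
      + ∑ x, W x * (if x u = 1 then 0 else 1) := by
    rw [← Finset.sum_add_distrib]
    exact Finset.sum_congr rfl fun x _ => by split_ifs <;> ring
  change ∑ x : Fin N → Fin 2, W x * _ ≤ lam / (1 + lam) * ∑ x : Fin N → Fin 2, W x
  rw [hsplit, div_mul_eq_mul_div, le_div_iff₀ (by linarith)]
  linarith

/-- The indicator that both nodes of a hyperedge are occupied. -/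
def bothOccupied (_ : Unit) (y : Fin 2 → Fin 2) : ℝ := if y 0 = 1 ∧ y 1 = 1 then 1 else 0

theorem bothOccupied_nonneg (a : Unit) (y : Fin 2 → Fin 2) : 0 ≤ bothOccupied a y :=
  indicator_nonneg _

theorem bothOccupied_le (a : Unit) (y : Fin 2 → Fin 2) :
    bothOccupied a y ≤ if y 0 = 1 then 1 else 0 := by
  unfold bothOccupied
  split_ifs <;> simp_all

theorem powBot_independentSet_edge (lam : ℝ) (a : Unit) (y : Fin 2 → Fin 2) :
    powBot lam (independentSet.edge a y) = 1 * (1 - bothOccupied a y) := by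
  change powBot lam (if y 0 = 1 ∧ y 1 = 1 then ⊥ else 0) = _
  unfold bothOccupied
  split_ifs
  · simp [powBot]
  · simp [powBot_zero]

theorem bothOccupied_replica (k : ℕ) :
    ∃ (S : Type) (_ : Fintype S) (c : ℝ) (φ : S → (Fin k → Fin 2) → ℝ),
      0 ≤ c ∧ (∀ s v, 0 ≤ φ s v) ∧ ∀ y : Fin k → Fin 2 → Fin 2,
        ∑ a, ∏ l, bothOccupied a (y l) = c * ∑ s, ∏ j, φ s fun l => y l j := by
  refine ⟨Unit, inferInstance, 1, fun _ u => if ∀ l, u l = 1 then 1 else 0,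
    zero_le_one, fun _ _ => indicator_nonneg _, fun y => ?_⟩
  unfold bothOccupied
  rw [Fintype.sum_unique, Fintype.sum_unique, prod_indicator, one_mul, Fin.prod_univ_two,
    ite_zero_mul_ite_zero]
  simp only [forall_and, mul_one]

theorem interpolable_independentSet {lam : ℝ} (hlam : 0 < lam) :
    independentSet.Interpolable lam 1 (lam / (1 + lam)) bothOccupied where
  lam_pos := hlam
  two_le_K := le_rfl
  q_pos := two_pos
  A_pos := one_pos
  α_lt_one := by
    rw [div_lt_one (by linarith)]
    linarith
  g_nonneg := bothOccupied_nonneg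
  powBot_edge := powBot_independentSet_edge lam
  gibbs_le N s e := by
    refine le_trans ?_ (independentSet_sum_occupied_le hlam s (e.1 (0 : Fin 2)))
    exact Finset.sum_le_sum fun x _ => mul_le_mul_of_nonneg_left (bothOccupied_le _ _)
      (weight_nonneg _ hlam s x)
  replica := bothOccupied_replica

/-- The replicated indicator of violation of a K-SAT clause factorizes over its nodes, because the
signs of different nodes are independent. -/
theorem interpolable_kSat {lam : ℝ} (hlam : 1 ≤ lam) {K : ℕ} (hK : 2 ≤ K) :
    (kSat K).Interpolable lam lam (1 - lam⁻¹)
      (fun (a y : Fin K → Fin 2) => (1 - lam⁻¹) * if y = a then 1 else 0) := by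
  refine interpolable_of_soft K 2 (Fin K → Fin 2) _ _ (fun a y => if y = a then 1 else 0) hK two_pos
    (by linarith) (by linarith) (one_sub_inv_mem hlam).1 (one_sub_inv_mem hlam).2
    (fun _ _ => indicator_nonneg _) (fun _ _ => indicator_le_one _)
    (fun _ _ => powBot_unit_eq hlam _) fun k => ⟨Unit, inferInstance,
      fun _ u => ∑ b : Fin 2, ∏ l, if u l = b then 1 else 0, fun _ _ => Finset.sum_nonneg fun _ _ =>
        Finset.prod_nonneg fun _ _ => indicator_nonneg _, fun y => ?_⟩
  rw [Fintype.sum_unique (ι := Unit), Finset.prod_univ_sum, Fintype.piFinset_univ]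
  refine Finset.sum_congr rfl fun a _ => ?_
  rw [Finset.prod_comm]
  refine Finset.prod_congr rfl fun l _ => ?_
  rw [prod_indicator]
  simp only [funext_iff]

/-- A clause of NAE-K-SAT is violated by `a` and by its negation; adding `σ : Fin 2` to every
coordinate selects one of the two. -/
theorem nae_indicator_eq_sum {K : ℕ} (hK : 0 < K) (a y : Fin K → Fin 2) :
    (if y = a ∨ y = (fun k => 1 - a k) then (1 : ℝ) else 0)
      = ∑ σ : Fin 2, ∏ j, if y j = a j + σ then 1 else 0 := by
  have h1 : ∀ b : Fin 2, b + 1 = 1 - b := by decide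
  have h2 : ∀ b : Fin 2, b ≠ 1 - b := by decide
  have h3 : a ≠ fun k => 1 - a k := fun h => h2 (a ⟨0, hK⟩) (congrFun h ⟨0, hK⟩)
  rw [Fin.sum_univ_two, prod_indicator, prod_indicator]
  simp only [add_zero, h1, ← funext_iff]
  by_cases ha : y = a
  · subst ha
    simp [h3]
  · simp [ha]

theorem interpolable_naeKSat {lam : ℝ} (hlam : 1 ≤ lam) {K : ℕ} (hK : 2 ≤ K) :
    (naeKSat K).Interpolable lam lam (1 - lam⁻¹) (fun (a y : Fin K → Fin 2) =>
      (1 - lam⁻¹) * if y = a ∨ y = (fun k => 1 - a k) then 1 else 0) := by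
  refine interpolable_of_soft K 2 (Fin K → Fin 2) _ _
    (fun a y => if y = a ∨ y = (fun k => 1 - a k) then 1 else 0) hK two_pos
    (by linarith) (by linarith) (one_sub_inv_mem hlam).1 (one_sub_inv_mem hlam).2
    (fun _ _ => indicator_nonneg _) (fun _ _ => indicator_le_one _)
    (fun _ _ => powBot_unit_eq hlam _) fun k => ⟨Fin k → Fin 2, inferInstance,
      fun σ u => ∑ b : Fin 2, ∏ l, if u l = b + σ l then 1 else 0,
      fun _ _ => Finset.sum_nonneg fun _ _ =>
        Finset.prod_nonneg fun _ _ => indicator_nonneg _, fun y => ?_⟩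
  simp only [nae_indicator_eq_sum (by omega : 0 < K), Finset.prod_univ_sum, Fintype.piFinset_univ]
  rw [Finset.sum_comm]
  refine Finset.sum_congr rfl fun σ _ => Finset.sum_congr rfl fun a _ => ?_
  rw [Finset.prod_comm]

theorem one_le_powBot_coloring_edge {lam : ℝ} (hlam : 1 ≤ lam) (q : ℕ) (a : Unit)
    (y : Fin 2 → Fin q) : 1 ≤ powBot lam ((coloring q).edge a y) :=
  one_le_powBot_unit hlam (y 0 = y 1)

theorem one_le_powBot_kSat_edge {lam : ℝ} (hlam : 1 ≤ lam) (K : ℕ) (a y : Fin K → Fin 2) :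
    1 ≤ powBot lam ((kSat K).edge a y) :=
  one_le_powBot_unit hlam (y = a)

theorem one_le_powBot_naeKSat_edge {lam : ℝ} (hlam : 1 ≤ lam) (K : ℕ) (a y : Fin K → Fin 2) :
    1 ≤ powBot lam ((naeKSat K).edge a y) :=
  one_le_powBot_unit hlam (y = a ∨ y = fun k => 1 - a k)

theorem powBot_independentSet_edge_le_one (lam : ℝ) (a : Unit) (y : Fin 2 → Fin 2) :
    powBot lam (independentSet.edge a y) ≤ 1 := by
  rw [powBot_independentSet_edge, one_mul]
  exact sub_le_self _ (bothOccupied_nonneg _ _)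

end SpinModel

/-! ### The scaling limits -/

theorem theorem2 (lam : ℝ) (hlam : 1 ≤ lam) :
    (∃ z : ℝ → ℝ, SpinModel.independentSet.LogPartitionLimit lam z ∧
      (∃ L : ℝ≥0, LipschitzOnWith L z (Set.Ioi 0)) ∧ AntitoneOn z (Set.Ioi 0)) ∧
    (∃ z : ℝ → ℝ, SpinModel.maxCut.LogPartitionLimit lam z ∧
      (∃ L : ℝ≥0, LipschitzOnWith L z (Set.Ioi 0)) ∧ MonotoneOn z (Set.Ioi 0)) ∧
    (∀ β B : ℝ, 0 < β → ∃ z : ℝ → ℝ, (SpinModel.ising β B).LogPartitionLimit lam z ∧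
      (∃ L : ℝ≥0, LipschitzOnWith L z (Set.Ioi 0))) ∧
    (∀ q : ℕ, 1 ≤ q → ∃ z : ℝ → ℝ, (SpinModel.coloring q).LogPartitionLimit lam z ∧
      (∃ L : ℝ≥0, LipschitzOnWith L z (Set.Ioi 0)) ∧ MonotoneOn z (Set.Ioi 0)) ∧
    (∀ K : ℕ, 2 ≤ K → ∃ z : ℝ → ℝ, (SpinModel.kSat K).LogPartitionLimit lam z ∧
      (∃ L : ℝ≥0, LipschitzOnWith L z (Set.Ioi 0)) ∧ MonotoneOn z (Set.Ioi 0)) ∧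
    (∀ K : ℕ, 2 ≤ K → ∃ z : ℝ → ℝ, (SpinModel.naeKSat K).LogPartitionLimit lam z ∧
      (∃ L : ℝ≥0, LipschitzOnWith L z (Set.Ioi 0)) ∧ MonotoneOn z (Set.Ioi 0)) := by
  have hlam0 : 0 < lam := by linarith
  have hcol : ∀ q : ℕ, 1 ≤ q → ∃ z : ℝ → ℝ, (SpinModel.coloring q).LogPartitionLimit lam z ∧
      (∃ L : ℝ≥0, LipschitzOnWith L z (Set.Ioi 0)) ∧ MonotoneOn z (Set.Ioi 0) := by
    intro q hq
    obtain ⟨z, hz, hL, hmono, -⟩ := (SpinModel.interpolable_coloring hlam hq).exists_limit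
    exact ⟨z, hz, hL, hmono (SpinModel.one_le_powBot_coloring_edge hlam q)⟩
  refine ⟨?_, hcol 2 one_le_two, ?_, hcol, ?_, ?_⟩
  · obtain ⟨z, hz, hL, -, hanti⟩ := (SpinModel.interpolable_independentSet hlam0).exists_limit
    exact ⟨z, hz, hL, hanti (SpinModel.powBot_independentSet_edge_le_one lam)⟩
  · intro β B hβ
    obtain ⟨z, hz, hL, -, -⟩ := (SpinModel.interpolable_ising hlam hβ B).exists_limit
    exact ⟨z, hz, hL⟩
  · intro K hK
    obtain ⟨z, hz, hL, hmono, -⟩ := (SpinModel.interpolable_kSat hlam hK).exists_limit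
    exact ⟨z, hz, hL, hmono (SpinModel.one_le_powBot_kSat_edge hlam K)⟩
  · intro K hK
    obtain ⟨z, hz, hL, hmono, -⟩ := (SpinModel.interpolable_naeKSat hlam hK).exists_limit
    exact ⟨z, hz, hL, hmono (SpinModel.one_le_powBot_naeKSat_edge hlam K)⟩
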